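/- **Setting.** There are $n$ nodes $p_1,\dots,p_n$. Every ordered pair of different nodes has a channel that holds at most $\mathsf{capacity}$ packets and may lose, duplicate and reorder them; sending into a full channel overwrites an arbitrary packet of it. An array $reg$ has one entry per node, and each entry is $\bot$ or a pair $(v,t)$ of an object value and an integer timestamp. Entries are compared by $(\bullet,t)\preceq(\bullet,t')\iff t\le t'$, with $\bot$ below everything, and arrays are compared entrywise; maxima of entries are taken for $\preceq$, with ties broken arbitrarily. Only timestamps of non-$\bot$ entries count below. **The algorithm (code for $p_i$).** Node $p_i$ has integers $ts$, $ssn$ and an array $reg$. The macro $\mathrm{merge}(Rec)$ sets $ts\gets\max(\{ts,reg[i].ts\}\cup\{r[i].ts: r\in Rec\})$ and, for all $k$, $reg[k]\gets\max(\{reg[k]\}\cup\{r[k]:r\in Rec\})$. * *Do forever:* delete each stored $\mathrm{SNAPSHOTack}(-,ssn')$ with $ssn'\ne ssn$; $ts\gets\max\{ts,reg[i].ts\}$; for each $k\neq i$ send $\mathrm{GOSSIP}(reg[k])$ to $p_k$. * *write(v):* $ts\gets ts+1$; $reg[i]\gets(v,ts)$; $lReg:=reg$; repeat broadcasting $\mathrm{WRITE}(lReg)$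 until $\mathrm{WRITEack}(regJ\succeq lReg)$ has been received from a majority; then merge the arrays so received and return. * *snapshot():* repeat [$prev:=reg$; $ssn\gets ssn+1$; repeat broadcasting $\mathrm{SNAPSHOT}(reg,ssn)$ until $\mathrm{SNAPSHOTack}(-,ssnJ=ssn)$ has been received from a majority; merge the arrays so received] until $prev=reg$; return $reg$. * *Arrival of* $\mathrm{GOSSIP}(regJ)$: $reg[i]\gets\max\{reg[i],regJ\}$, $ts\gets\max\{ts,reg[i].ts\}$. *Arrival of* $\mathrm{WRITE}(regJ)$ or $\mathrm{SNAPSHOT}(regJ,s)$ from $p_j$: $reg[k]\gets\max(reg[k],regJ[k])$ for all $k$, then reply $\mathrm{WRITEack}(reg)$, respectively $\mathrm{SNAPSHOTack}(reg,s)$, to $p_j$. Acknowledgments that match no ongoing wait are ignored. A node has at most one operation in progress, invoked at arbitrary times. A node that broadcasts serves its message to itself within one step. The steps of the do-forever loop, of the ongoing operation, the arrivals and the channel faults interleave arbitrarily. The set of acknowledgments an operation has received is part of its local state and is discarded when its wait for a majority ends. **Executions.** An unbounded execution is an infinite sequence $c_0,a_0,c_1,a_1,\dots$ of system states and steps, where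 $c_0$ is arbitrary (local variables, operations in progress with their local state and stored acknowledgments, packets in transit within the capacity). It is *fair* if every node takes infinitely many steps of its do-forever loop; an operation that is in progress infinitely often takes infinitely many steps; a packet that is in transit infinitely often is received infinitely often; every packet is duplicated only finitely often; and whenever a node sends messages of one of the five kinds infinitely often to another node, that node receives infinitely many of the messages of this kind so sent. **Asynchronous cycles.** A *complete iteration* of $p_i$ from $c_b$ to $c_e$ means: (i) step $a_b$ executes the first line of its do-forever loop and this pass through the loop is completed before $c_e$; (ii) if, when the pass is completed, an operation of $p_i$ waits for a majority, then before $c_e$ either this wait ends, or the request it concerns has been sent by $p_i$, received and answered by the receiver, and the answer received by $p_i$, all between $c_b$ and $c_e$, for every receiver; (iii) between $c_b$ and $c_e$ every other node receives a gossip message from $p_i$. The first asynchronous cycle of an execution is its shortest prefix in which every node has a complete iteration, the second cycle is the first cycle of the remaining suffix, and so on. Transit assumption, with a constant $K$: for every suffix of the execution, the packets (and their copies) in transit at its start have arrived or left the channel by the end of its first $K$ cycles. **Theorem.** For every $K$ there is a constant $C$ that depends only on $K$ (not on $n$, the capacity, the set of object values, or the execution) such that for every fair unbounded execution of the algorithm,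 from an arbitrary starting state, that satisfies the transit assumption with $K$: the first $C$ asynchronous cycles exist and, by their end, the system reaches a state $c$ in which, for every node $p_i$ simultaneously, 1. $ts_i$ is at least every timestamp of $p_i$ in $c$, that is, $ts_i\ge r[i].ts$ for $r=reg_j$ and for every other array $r$ in the local state of any node $p_j$ (its $lReg$, its $prev$, the array it is broadcasting, its stored acknowledgments) and for the array $r$ in any message in transit, and $ts_i\ge e.ts$ for every $\mathrm{GOSSIP}(e)$ in transit to $p_i$; and 2. $ssn_i$ is at least every snapshot sequence number of $p_i$ in $c$, that is, those in the $\mathrm{SNAPSHOT}$ messages in transit from $p_i$, in the $\mathrm{SNAPSHOTack}$ messages in transit to $p_i$, and in the $\mathrm{SNAPSHOTack}$s stored at $p_i$. -/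

import Mathlib

open Filter

namespace Snap

/-! ## Register entries and arrays -/

/-- An entry of the array `reg`: `none` is the symbol `⊥`, and `some (v, t)` is the object value `v`
with the write-operation index (timestamp) `t`. -/
abbrev Entry (V : Type*) := Option (V × ℤ)

/-- An array with one entry per node. -/
abbrev Reg (n : ℕ) (V : Type*) := Fin n → Entry V

/-- The relation `⪯` on entries: compare timestamps only; `⊥` is below every entry. -/
def entryLE {V : Type*} : Entry V → Entry V → Prop
  | none, _ => True
  | some _, none => False
  | some (_, t), some (_, t') => t ≤ t'

/-- The relation `⪯` on arrays. -/
def regLE {n : ℕ} {V : Type*} (r r' : Reg n V) : Prop := ∀ k, entryLE (r k) (r' k)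

/-- `e` is a maximum of the set `S` of entries with respect to `⪯`. Between entries with the same
timestamp either choice is allowed. -/
def IsMaxEntry {V : Type*} (S : Set (Entry V)) (e : Entry V) : Prop :=
  e ∈ S ∧ ∀ s ∈ S, entryLE s e

/-- The timestamp carried by an entry, as a set: empty for `⊥`, and otherwise a singleton. -/
def entryTs {V : Type*} (e : Entry V) : Set ℤ := {t | ∃ v, e = some (v, t)}

/-- The server-side update `for all k: reg[k] ← max (reg[k], regJ[k])`. -/
def MaxReg {n : ℕ} {V : Type*} (reg regJ reg' : Reg n V) : Prop :=
  ∀ k, IsMaxEntry {reg k, regJ k} (reg' k)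

/-- The macro `merge(Rec)` at node `i`, from `(ts, reg)` to `(ts', reg')`. -/
def Merge {n : ℕ} {V : Type*} (i : Fin n) (Rec : Set (Reg n V))
    (ts : ℤ) (reg : Reg n V) (ts' : ℤ) (reg' : Reg n V) : Prop :=
  IsGreatest ({ts} ∪ entryTs (reg i) ∪ ⋃ r ∈ Rec, entryTs (r i)) ts' ∧
    ∀ k, IsMaxEntry ({reg k} ∪ (fun r : Reg n V => r k) '' Rec) (reg' k)

/-! ## Messages, packets, node states and system states -/

inductive Kind
  | gossip | write | writeAck | snapshot | snapshotAck

inductive Msg (n : ℕ) (V : Type*)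
  | gossip (e : Entry V)
  | write (r : Reg n V)
  | writeAck (r : Reg n V)
  | snapshot (r : Reg n V) (ssn : ℤ)
  | snapshotAck (r : Reg n V) (ssn : ℤ)

def Msg.kind {n : ℕ} {V : Type*} : Msg n V → Kind
  | .gossip _ => .gossip
  | .write _ => .write
  | .writeAck _ => .writeAck
  | .snapshot _ _ => .snapshot
  | .snapshotAck _ _ => .snapshotAck

/-- A packet: a message together with a label that no node can read and that only serves to speak
about executions. The label is `0` for a packet of the starting system state, and `x + 1` for a packet
transmitted by step `a x` (so `c (x + 1)` is the first state that contains it). A copy that the channel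
makes of a packet keeps the label. -/
structure Packet (n : ℕ) (V : Type*) where
  msg : Msg n V
  sentAt : ℕ

/-- The client side of a node. In an ongoing operation, `dest` is the position in the current sweep
of the broadcast (the next destination if `dest < n`; otherwise the `until` test is next), and `acks`
holds the acknowledgments that were received, with their senders.
* `write lReg dest acks`: inside the repeat-until loop of `write()`;
* `snapshot prev out dest acks`: inside the inner repeat-until loop of `snapshot()`, where `out` is
  the array in the `SNAPSHOT` message of the current broadcast. -/
inductive Client (n : ℕ) (V : Type*)
  | idle
  | write (lReg : Reg n V) (dest : ℕ) (acks : Multiset (Fin n × Reg n V))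
  | snapshot (prev out : Reg n V) (dest : ℕ) (acks : Multiset (Fin n × Reg n V × ℤ))

/-- The position of the client in the current sweep of its broadcast (irrelevant when idle). -/
def Client.dest {n : ℕ} {V : Type*} : Client n V → ℕ
  | .idle => 0
  | .write _ d _ => d
  | .snapshot _ _ d _ => d

/-- Delete every stored `SNAPSHOTack(-, ssn')` with `ssn' ≠ ssn`. -/
def Client.deleteStale {n : ℕ} {V : Type*} (ssn : ℤ) : Client n V → Client n V
  | .idle => .idle
  | .write lReg d acks => .write lReg d acks
  | .snapshot prev out d acks => .snapshot prev out d (acks.filter fun a => a.2.2 = ssn)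

/-- The local state of a node. `pc` is the position in the do-forever loop: `0` at its first line,
`k + 1` before the gossip to node `k`, and larger than `n` at the end of the loop's body. -/
structure Node (n : ℕ) (V : Type*) where
  ts : ℤ
  ssn : ℤ
  reg : Reg n V
  pc : ℕ
  client : Client n V

/-- A system state: the node states, and the packets in transit from `i` to `j` in `chan i j`. -/
structure State (n : ℕ) (V : Type*) where
  node : Fin n → Node n V
  chan : Fin n → Fin n → Multiset (Packet n V)

def State.setNode {n : ℕ} {V : Type*} (c : State n V) (i : Fin n) (nd : Node n V) : State n V :=
  { c with node := Function.update c.node i nd }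

def State.setChan {n : ℕ} {V : Type*} (c : State n V) (i j : Fin n) (ch : Multiset (Packet n V)) :
    State n V :=
  { c with chan := Function.update c.chan i (Function.update (c.chan i) j ch) }

/-- The `send` operation on a channel of capacity `cap`: insert the packet; in case the channel is
full, the packet overwrites an arbitrary packet of the channel. -/
def Insert {n : ℕ} {V : Type*} (cap : ℕ) (ch : Multiset (Packet n V)) (p : Packet n V)
    (ch' : Multiset (Packet n V)) : Prop :=
  (ch.card < cap ∧ ch' = p ::ₘ ch) ∨
    (cap ≤ ch.card ∧ ∃ q rest, ch = q ::ₘ rest ∧ ch' = p ::ₘ rest)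

/-- `c'` results from `c` when node `i` sends the message `m` to node `j` in step number `x`. -/
def Sends {n : ℕ} {V : Type*} (cap x : ℕ) (i j : Fin n) (m : Msg n V) (c c' : State n V) : Prop :=
  ∃ ch', Insert cap (c.chan i j) ⟨m, x + 1⟩ ch' ∧ c' = c.setChan i j ch'

/-! ## The quorum conditions of the two repeat-until loops -/

/-- The arrays `regJ ⪰ lReg` that were received in `WRITEack` messages. -/
def writeRec {n : ℕ} {V : Type*} (lReg : Reg n V) (acks : Multiset (Fin n × Reg n V)) :
    Set (Reg n V) :=
  {r | ∃ j, (j, r) ∈ acks ∧ regLE lReg r}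

/-- `WRITEack(regJ ⪰ lReg)` received from a majority. -/
def WriteQuorum {n : ℕ} {V : Type*} (lReg : Reg n V) (acks : Multiset (Fin n × Reg n V)) : Prop :=
  n < 2 * {j : Fin n | ∃ r, (j, r) ∈ acks ∧ regLE lReg r}.ncard

/-- The arrays that were received in messages `SNAPSHOTack(-, ssnJ = ssn)`. -/
def snapRec {n : ℕ} {V : Type*} (ssn : ℤ) (acks : Multiset (Fin n × Reg n V × ℤ)) :
    Set (Reg n V) :=
  {r | ∃ j, (j, r, ssn) ∈ acks}

/-- `SNAPSHOTack(-, ssnJ = ssn)` received from a majority. -/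
def SnapQuorum {n : ℕ} {V : Type*} (ssn : ℤ) (acks : Multiset (Fin n × Reg n V × ℤ)) : Prop :=
  n < 2 * {j : Fin n | ∃ r, (j, r, ssn) ∈ acks}.ncard

/-- The node is at the `until` test of a repeat-until loop, and the test succeeds. -/
def Node.QuorumReached {n : ℕ} {V : Type*} (nd : Node n V) : Prop :=
  match nd.client with
  | .idle => False
  | .write lReg dest acks => n ≤ dest ∧ WriteQuorum lReg acks
  | .snapshot _ _ dest acks => n ≤ dest ∧ SnapQuorum nd.ssn acks

/-! ## The steps of the algorithm and of the channels -/

/-- The labels of steps.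
* `loop i`: node `i` takes the next step of its do-forever loop;
* `invokeWrite i v`, `invokeSnapshot i`: an operation is invoked at node `i`;
* `client i`: node `i` takes the next step of its ongoing operation;
* `deliver j i p`: node `i` receives from node `j` the packet `p`, and runs the arrival event;
* `lose j i p`, `duplicate j i p`: omission and duplication of a packet in transit from `j` to `i`.
Channels are multisets, so reordering needs no step of its own. -/
inductive Act (n : ℕ) (V : Type*)
  | loop (i : Fin n)
  | invokeWrite (i : Fin n) (v : V)
  | invokeSnapshot (i : Fin n)
  | client (i : Fin n)
  | deliver (j i : Fin n) (p : Packet n V)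
  | lose (j i : Fin n) (p : Packet n V)
  | duplicate (j i : Fin n) (p : Packet n V)

/-- `Step cap x c a c'`: the step `a`, taken as step number `x`, leads from `c` to `c'`. -/
inductive Step {n : ℕ} {V : Type*} (cap x : ℕ) : State n V → Act n V → State n V → Prop
  /-- First lines of the do-forever loop: delete stale `SNAPSHOTack`s; `ts ← max {ts, reg[i].ts}`. -/
  | loopFirst (c : State n V) (i : Fin n) (ts' : ℤ)
      (hpc : (c.node i).pc = 0)
      (hts : IsGreatest ({(c.node i).ts} ∪ entryTs ((c.node i).reg i)) ts') :
      Step cap x c (.loop i) (c.setNode i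
        { c.node i with
          ts := ts'
          pc := 1
          client := (c.node i).client.deleteStale (c.node i).ssn })
  /-- `send GOSSIP(reg[k]) to p_k`, for `k ≠ i`. -/
  | loopGossip (c c' : State n V) (i k : Fin n)
      (hpc : (c.node i).pc = k + 1) (hk : k ≠ i)
      (hs : Sends cap x i k (.gossip ((c.node i).reg k))
        (c.setNode i { c.node i with pc := k + 2 }) c') :
      Step cap x c (.loop i) c'
  /-- The case `k = i` of the gossip loop: nothing to send. -/
  | loopSkip (c : State n V) (i : Fin n)
      (hpc : (c.node i).pc = i + 1) :
      Step cap x c (.loop i) (c.setNode i { c.node i with pc := i + 2 })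
  /-- End of the body of the do-forever loop. -/
  | loopEnd (c : State n V) (i : Fin n)
      (hpc : n < (c.node i).pc) :
      Step cap x c (.loop i) (c.setNode i { c.node i with pc := 0 })
  /-- `write(v)`: `ts ← ts + 1; reg[i] ← (v, ts)`; let `lReg := reg`. -/
  | invokeWrite (c : State n V) (i : Fin n) (v : V) (reg' : Reg n V)
      (hc : (c.node i).client = .idle)
      (hr : reg' = Function.update (c.node i).reg i (some (v, (c.node i).ts + 1))) :
      Step cap x c (.invokeWrite i v) (c.setNode i
        { c.node i with
          ts := (c.node i).ts + 1
          reg := reg'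
          client := .write reg' 0 0 })
  /-- `broadcast WRITE(lReg)`: the message to another node `k`. -/
  | writeSend (c c' : State n V) (i k : Fin n) (lReg : Reg n V)
      (acks : Multiset (Fin n × Reg n V))
      (hc : (c.node i).client = .write lReg k acks) (hk : k ≠ i)
      (hs : Sends cap x i k (.write lReg)
        (c.setNode i { c.node i with client := .write lReg (k + 1) acks }) c') :
      Step cap x c (.client i) c'
  /-- `broadcast WRITE(lReg)`: the message to itself, with its arrival and its acknowledgment. -/
  | writeSelf (c : State n V) (i : Fin n) (lReg reg' : Reg n V)
      (acks : Multiset (Fin n × Reg n V))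
      (hc : (c.node i).client = .write lReg i acks)
      (hr : MaxReg (c.node i).reg lReg reg') :
      Step cap x c (.client i) (c.setNode i
        { c.node i with
          reg := reg'
          client := .write lReg (i + 1) ((i, reg') ::ₘ acks) })
  /-- The `until` test of `write()` fails: broadcast again. -/
  | writeRetry (c : State n V) (i : Fin n) (lReg : Reg n V) (d : ℕ)
      (acks : Multiset (Fin n × Reg n V))
      (hc : (c.node i).client = .write lReg d acks) (hd : n ≤ d)
      (hq : ¬ WriteQuorum lReg acks) :
      Step cap x c (.client i) (c.setNode i
        { c.node i with client := .write lReg 0 acks })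
  /-- The `until` test of `write()` succeeds: `merge(Rec)` and return. -/
  | writeReturn (c : State n V) (i : Fin n) (lReg : Reg n V) (d : ℕ)
      (acks : Multiset (Fin n × Reg n V)) (ts' : ℤ) (reg' : Reg n V)
      (hc : (c.node i).client = .write lReg d acks) (hd : n ≤ d)
      (hq : WriteQuorum lReg acks)
      (hm : Merge i (writeRec lReg acks) (c.node i).ts (c.node i).reg ts' reg') :
      Step cap x c (.client i) (c.setNode i
        { c.node i with ts := ts', reg := reg', client := .idle })
  /-- `snapshot()`: first iteration of the outer loop: let `prev := reg`; `ssn ← ssn + 1`. -/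
  | invokeSnapshot (c : State n V) (i : Fin n)
      (hc : (c.node i).client = .idle) :
      Step cap x c (.invokeSnapshot i) (c.setNode i
        { c.node i with
          ssn := (c.node i).ssn + 1
          client := .snapshot (c.node i).reg (c.node i).reg 0 0 })
  /-- `broadcast SNAPSHOT(reg, ssn)`: the message to another node `k`. -/
  | snapSend (c c' : State n V) (i k : Fin n) (prev out : Reg n V)
      (acks : Multiset (Fin n × Reg n V × ℤ))
      (hc : (c.node i).client = .snapshot prev out k acks) (hk : k ≠ i)
      (hs : Sends cap x i k (.snapshot out (c.node i).ssn)
        (c.setNode i { c.node i with client := .snapshot prev out (k + 1) acks }) c') :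
      Step cap x c (.client i) c'
  /-- `broadcast SNAPSHOT(reg, ssn)`: the message to itself, with its arrival and its
  acknowledgment. -/
  | snapSelf (c : State n V) (i : Fin n) (prev out reg' : Reg n V)
      (acks : Multiset (Fin n × Reg n V × ℤ))
      (hc : (c.node i).client = .snapshot prev out i acks)
      (hr : MaxReg (c.node i).reg out reg') :
      Step cap x c (.client i) (c.setNode i
        { c.node i with
          reg := reg'
          client := .snapshot prev out (i + 1) ((i, reg', (c.node i).ssn) ::ₘ acks) })
  /-- The inner `until` test of `snapshot()` fails: broadcast again, with the current `reg`. -/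
  | snapRetry (c : State n V) (i : Fin n) (prev out : Reg n V) (d : ℕ)
      (acks : Multiset (Fin n × Reg n V × ℤ))
      (hc : (c.node i).client = .snapshot prev out d acks) (hd : n ≤ d)
      (hq : ¬ SnapQuorum (c.node i).ssn acks) :
      Step cap x c (.client i) (c.setNode i
        { c.node i with client := .snapshot prev (c.node i).reg 0 acks })
  /-- The inner `until` test succeeds, and after `merge(Rec)` also the outer one, `prev = reg`:
  return. -/
  | snapReturn (c : State n V) (i : Fin n) (prev out : Reg n V) (d : ℕ)
      (acks : Multiset (Fin n × Reg n V × ℤ)) (ts' : ℤ) (reg' : Reg n V)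
      (hc : (c.node i).client = .snapshot prev out d acks) (hd : n ≤ d)
      (hq : SnapQuorum (c.node i).ssn acks)
      (hm : Merge i (snapRec (c.node i).ssn acks) (c.node i).ts (c.node i).reg ts' reg')
      (hp : prev = reg') :
      Step cap x c (.client i) (c.setNode i
        { c.node i with ts := ts', reg := reg', client := .idle })
  /-- The inner `until` test succeeds, but after `merge(Rec)` the outer one fails: next iteration
  of the outer loop. -/
  | snapAgain (c : State n V) (i : Fin n) (prev out : Reg n V) (d : ℕ)
      (acks : Multiset (Fin n × Reg n V × ℤ)) (ts' : ℤ) (reg' : Reg n V)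
      (hc : (c.node i).client = .snapshot prev out d acks) (hd : n ≤ d)
      (hq : SnapQuorum (c.node i).ssn acks)
      (hm : Merge i (snapRec (c.node i).ssn acks) (c.node i).ts (c.node i).reg ts' reg')
      (hp : prev ≠ reg') :
      Step cap x c (.client i) (c.setNode i
        { c.node i with
          ts := ts'
          reg := reg'
          ssn := (c.node i).ssn + 1
          client := .snapshot reg' reg' 0 0 })
  /-- Arrival of `GOSSIP(regJ)`: `reg[i] ← max {reg[i], regJ}; ts ← max {ts, reg[i].ts}`. -/
  | gossipArrival (c : State n V) (j i : Fin n) (p : Packet n V) (rest : Multiset (Packet n V))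
      (e e' : Entry V) (ts' : ℤ)
      (hch : c.chan j i = p ::ₘ rest) (hp : p.msg = .gossip e)
      (he : IsMaxEntry {(c.node i).reg i, e} e')
      (hts : IsGreatest ({(c.node i).ts} ∪ entryTs e') ts') :
      Step cap x c (.deliver j i p) ((c.setChan j i rest).setNode i
        { c.node i with ts := ts', reg := Function.update (c.node i).reg i e' })
  /-- Arrival of `WRITE(regJ)`: update `reg`, and reply `WRITEack(reg)`. -/
  | writeArrival (c c' : State n V) (j i : Fin n) (p : Packet n V)
      (rest : Multiset (Packet n V)) (r reg' : Reg n V)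
      (hch : c.chan j i = p ::ₘ rest) (hp : p.msg = .write r)
      (hr : MaxReg (c.node i).reg r reg')
      (hs : Sends cap x i j (.writeAck reg')
        ((c.setChan j i rest).setNode i { c.node i with reg := reg' }) c') :
      Step cap x c (.deliver j i p) c'
  /-- Arrival of `SNAPSHOT(regJ, ssn)`: update `reg`, and reply `SNAPSHOTack(reg, ssn)`. -/
  | snapArrival (c c' : State n V) (j i : Fin n) (p : Packet n V)
      (rest : Multiset (Packet n V)) (r reg' : Reg n V) (s : ℤ)
      (hch : c.chan j i = p ::ₘ rest) (hp : p.msg = .snapshot r s)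
      (hr : MaxReg (c.node i).reg r reg')
      (hs : Sends cap x i j (.snapshotAck reg' s)
        ((c.setChan j i rest).setNode i { c.node i with reg := reg' }) c') :
      Step cap x c (.deliver j i p) c'
  /-- Arrival of a `WRITEack(regJ ⪰ lReg)` that the ongoing `write()` waits for. -/
  | writeAckAccept (c : State n V) (j i : Fin n) (p : Packet n V)
      (rest : Multiset (Packet n V)) (r lReg : Reg n V) (d : ℕ)
      (acks : Multiset (Fin n × Reg n V))
      (hch : c.chan j i = p ::ₘ rest) (hp : p.msg = .writeAck r)
      (hc : (c.node i).client = .write lReg d acks) (hr : regLE lReg r) :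
      Step cap x c (.deliver j i p) ((c.setChan j i rest).setNode i
        { c.node i with client := .write lReg d ((j, r) ::ₘ acks) })
  /-- Any other `WRITEack` is ignored. -/
  | writeAckIgnore (c : State n V) (j i : Fin n) (p : Packet n V)
      (rest : Multiset (Packet n V)) (r : Reg n V)
      (hch : c.chan j i = p ::ₘ rest) (hp : p.msg = .writeAck r)
      (hc : ∀ lReg d acks, (c.node i).client = .write lReg d acks → ¬ regLE lReg r) :
      Step cap x c (.deliver j i p) (c.setChan j i rest)
  /-- Arrival of a `SNAPSHOTack(-, ssnJ = ssn)` that the ongoing `snapshot()` waits for. -/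
  | snapAckAccept (c : State n V) (j i : Fin n) (p : Packet n V)
      (rest : Multiset (Packet n V)) (r prev out : Reg n V) (d : ℕ)
      (acks : Multiset (Fin n × Reg n V × ℤ))
      (hch : c.chan j i = p ::ₘ rest) (hp : p.msg = .snapshotAck r (c.node i).ssn)
      (hc : (c.node i).client = .snapshot prev out d acks) :
      Step cap x c (.deliver j i p) ((c.setChan j i rest).setNode i
        { c.node i with client := .snapshot prev out d ((j, r, (c.node i).ssn) ::ₘ acks) })
  /-- Any other `SNAPSHOTack` is ignored. -/
  | snapAckIgnore (c : State n V) (j i : Fin n) (p : Packet n V)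
      (rest : Multiset (Packet n V)) (r : Reg n V) (s : ℤ)
      (hch : c.chan j i = p ::ₘ rest) (hp : p.msg = .snapshotAck r s)
      (hc : ∀ prev out d acks, (c.node i).client = .snapshot prev out d acks →
        s ≠ (c.node i).ssn) :
      Step cap x c (.deliver j i p) (c.setChan j i rest)
  /-- Packet omission. -/
  | lose (c : State n V) (j i : Fin n) (p : Packet n V) (rest : Multiset (Packet n V))
      (hch : c.chan j i = p ::ₘ rest) :
      Step cap x c (.lose j i p) (c.setChan j i rest)
  /-- Packet duplication, within the capacity of the channel. -/
  | duplicate (c : State n V) (j i : Fin n) (p : Packet n V)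
      (hp : p ∈ c.chan j i) (hcap : (c.chan j i).card < cap) :
      Step cap x c (.duplicate j i p) (c.setChan j i (p ::ₘ c.chan j i))

/-! ## Executions -/

/-- An unbounded execution `c 0, a 0, c 1, a 1, …` from an arbitrary system state. The starting
state is arbitrary up to the facts that hold in every system state: a channel has at most `cap`
packets, and connects two different nodes. -/
structure Execution (n cap : ℕ) (V : Type*) where
  c : ℕ → State n V
  a : ℕ → Act n V
  step : ∀ x, Step cap x (c x) (a x) (c (x + 1))
  init_card : ∀ i j, ((c 0).chan i j).card ≤ cap
  init_self : ∀ i, (c 0).chan i i = 0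
  init_label : ∀ i j, ∀ p ∈ (c 0).chan i j, p.sentAt = 0

namespace Execution

variable {n cap : ℕ} {V : Type*}

/-- Fair communication: if node `i` sends messages of some kind to node `j` infinitely often, then
node `j` receives infinitely many of the messages of this kind that `i` sends. -/
def FairComm (R : Execution n cap V) : Prop :=
  ∀ (i j : Fin n) (κ : Kind),
    (∃ᶠ x in atTop, ∃ m : Msg n V, m.kind = κ ∧ (⟨m, x + 1⟩ : Packet n V) ∈ (R.c (x + 1)).chan i j) →
    ∀ y, ∃ x p, y ≤ x ∧ R.a x = .deliver i j p ∧ p.msg.kind = κ ∧ y < p.sentAt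

/-- A fair execution: every node keeps running its do-forever loop, and its ongoing operations;
a packet that can be received infinitely often is received infinitely often; a packet is duplicated
only finitely often; and communication is fair. -/
structure Fair (R : Execution n cap V) : Prop where
  loop : ∀ i, ∃ᶠ x in atTop, R.a x = .loop i
  client : ∀ i, (∃ᶠ x in atTop, ((R.c x).node i).client ≠ .idle) →
    ∃ᶠ x in atTop, R.a x = .client i
  receive : ∀ i j p, (∃ᶠ x in atTop, p ∈ (R.c x).chan i j) →
    ∃ᶠ x in atTop, R.a x = .deliver i j p
  duplication : ∀ i j p, ∀ᶠ x in atTop, R.a x ≠ .duplicate i j p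
  comm : R.FairComm

/-! ## Asynchronous cycles -/

/-- In step `x`, node `i` ends a quorum access: the `until` test of the repeat-until loop of its
ongoing operation succeeds, and it stops waiting for replies to its request. -/
def EndsAccess (R : Execution n cap V) (i : Fin n) (x : ℕ) : Prop :=
  R.a x = .client i ∧ ((R.c x).node i).QuorumReached

/-- A request that node `i` sends to node `j` in step `s` completes its round-trip in step `u`:
`j` receives that request, replies in the same step, and `i` receives that reply in step `u`.
The message to itself is sent, received and acknowledged in one step. -/
def RoundTrip (R : Execution n cap V) (i j : Fin n) (s u : ℕ) : Prop :=
  R.a s = .client i ∧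
    ((j = i ∧ ((R.c s).node i).client.dest = i ∧ u = s) ∨
     (j ≠ i ∧ ∃ t p q, p.sentAt = s + 1 ∧ R.a t = .deliver i j p ∧
        q.sentAt = t + 1 ∧ R.a u = .deliver j i q))

/-- An iteration (with round-trips) of node `i` starts at the state `c b` and is over at `c e`:
(i) the iteration of the do-forever loop that starts in step `b` is completed, in step `d`;
(ii) if `i` still waits, at `c e`, for replies to a request of an operation that was in
progress during that iteration, then this request has completed, between `c b` and `c e`, a round-trip
with every node;
(iii) between `c b` and `c e` every other node has received a gossip message from `i`. -/
def Iteration (R : Execution n cap V) (i : Fin n) (b e : ℕ) : Prop :=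
  (R.a b = .loop i ∧ ((R.c b).node i).pc = 0) ∧
  (∃ d, b < d ∧ d < e ∧ R.a d = .loop i ∧ n < ((R.c d).node i).pc ∧
    (∀ x, b < x → x < d → R.a x = .loop i → ((R.c x).node i).pc ≤ n) ∧
    (((R.c d).node i).client ≠ .idle → (∀ x, d ≤ x → x < e → ¬ R.EndsAccess i x) →
      ∀ j, ∃ s u, b ≤ s ∧ u < e ∧ R.RoundTrip i j s u ∧
        ∀ x, s ≤ x → x < e → ¬ R.EndsAccess i x)) ∧
  (∀ j, j ≠ i → ∃ x p, b ≤ x ∧ x < e ∧ R.a x = .deliver i j p ∧ p.msg.kind = .gossip)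

/-- The first asynchronous cycle of the suffix that starts at `c x` ends at `c y`: the part from
`c x` to `c y` is the shortest one in which every node has a complete iteration. -/
def Cycle (R : Execution n cap V) (x y : ℕ) : Prop :=
  IsLeast {y | x ≤ y ∧ ∀ i, ∃ b e, x ≤ b ∧ e ≤ y ∧ R.Iteration i b e} y

/-- The first `k` asynchronous cycles of the suffix that starts at `c x` end at `c y`. -/
inductive Cycles (R : Execution n cap V) (x : ℕ) : ℕ → ℕ → Prop
  | zero : Cycles R x 0 x
  | succ {k y z : ℕ} : Cycles R x k y → R.Cycle y z → Cycles R x (k + 1) z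

/-- The messages in transit at a state `c x` arrive, or leave the channel, within `K` asynchronous
cycles: `K` cycles after `c x`, all packets in transit were transmitted after `c x`. -/
def TransitBound (R : Execution n cap V) (K : ℕ) : Prop :=
  ∀ x y, R.Cycles x K y → ∀ i j, ∀ p ∈ (R.c y).chan i j, x < p.sentAt

end Execution

/-! ## Consistent operation indices -/

/-- The timestamps of node `i` that occur in the client state of some node. -/
def Client.tsOf {n : ℕ} {V : Type*} (i : Fin n) : Client n V → Set ℤ
  | .idle => ∅
  | .write lReg _ acks => entryTs (lReg i) ∪ {t | ∃ a ∈ acks, t ∈ entryTs (a.2 i)}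
  | .snapshot prev out _ acks =>
      entryTs (prev i) ∪ entryTs (out i) ∪ {t | ∃ a ∈ acks, t ∈ entryTs (a.2.1 i)}

/-- The timestamps of node `i` in a message in transit to node `k`. A message `GOSSIP(e)` to `k`
carries the sender's copy of the entry of `k`. -/
def Msg.tsOf {n : ℕ} {V : Type*} (i k : Fin n) : Msg n V → Set ℤ
  | .gossip e => {t | k = i ∧ t ∈ entryTs e}
  | .write r => entryTs (r i)
  | .writeAck r => entryTs (r i)
  | .snapshot r _ => entryTs (r i)
  | .snapshotAck r _ => entryTs (r i)

/-- All timestamps of node `i` in a system state. -/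
def State.tsOf {n : ℕ} {V : Type*} (c : State n V) (i : Fin n) : Set ℤ :=
  {t | t = (c.node i).ts ∨
    (∃ j, t ∈ entryTs ((c.node j).reg i) ∨ t ∈ (c.node j).client.tsOf i) ∨
    (∃ j k, ∃ p ∈ c.chan j k, t ∈ p.msg.tsOf i k)}

/-- All snapshot sequence numbers of node `i` in a system state: its variable `ssn`, those of the
acknowledgments it stores, of its requests in transit, and of the replies in transit to it. -/
def State.ssnOf {n : ℕ} {V : Type*} (c : State n V) (i : Fin n) : Set ℤ :=
  {s | s = (c.node i).ssn ∨
    (∃ prev out d acks, (c.node i).client = .snapshot prev out d acks ∧ ∃ a ∈ acks, s = a.2.2) ∨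
    (∃ j, ∃ p ∈ c.chan i j, ∃ r, p.msg = .snapshot r s) ∨
    (∃ j, ∃ p ∈ c.chan j i, ∃ r, p.msg = .snapshotAck r s)}

/-- The timestamps are consistent: `ts` of every node is at least all timestamps of that node. -/
def State.TsConsistent {n : ℕ} {V : Type*} (c : State n V) : Prop :=
  ∀ i, ∀ t ∈ c.tsOf i, t ≤ (c.node i).ts

/-- The snapshot sequence numbers are consistent: `ssn` of every node is at least all snapshot
sequence numbers of that node. -/
def State.SsnConsistent {n : ℕ} {V : Type*} (c : State n V) : Prop :=
  ∀ i, ∀ s ∈ c.ssnOf i, s ≤ (c.node i).ssn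

end Snap

namespace Snap

/-! ### The order on entries, merging, and updates of states. -/

variable {n cap x : ℕ} {V : Type*}

/-! Fix a node `i`. Call a timestamp known (`Execution.knownTs`) if it is at most `ts` of `i`, or at
most the timestamp in some other node's copy of entry `i`. Known timestamps stay known, because `ts`
never falls and other nodes only raise their copies. The copy held by `i` itself is left out: a
write sets it to `ts + 1`, which may lower a corrupt value. The plan is to make all timestamps of
`i` known, and then to let gossip carry the known ones into `ts`.

Operations inherited from the starting state may use corrupt arrays, but no quorum access survives
three cycles (`Execution.Cycles.exists_fresh`): one cycle collects acknowledgments from all nodes,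
and two more force the client through its `until` test. After that the arrays of an operation are
copies of the node's own `reg` and remain dominated by it (`Execution.Cycles.reqTs_le`). Hence after
`K` more cycles the messages from nodes other than `i` carry known timestamps
(`Execution.TransitBound.tsOf_subset`). One pass through the first line of the loop then makes the
own entry of `i` known for good (`Execution.Cycles.reg_subset`). Another `K` cycles clean all
messages, and three more clean the stored acknowledgments (`Execution.Cycles.ackTs_subset`).

At this state every timestamp of `i` is known. A step creates only timestamps bounded by `ts`
(`Step.mem_tsOf`), so only this fixed stock has to be absorbed. Gossip does so within `K + 1` cycles
(`Execution.TransitBound.knownTs_le`).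

Sequence numbers are simpler, as `ssn` is monotone and only `i` issues its requests: one transit
period cleans the requests, a second one the replies, and the deletion in the loop cleans the store.

That cycles exist at all is a separate liveness argument from fairness
(`Execution.Fair.exists_iteration`). -/

theorem entryLE_refl (e : Entry V) : entryLE e e := by
  rcases e with _ | ⟨v, t⟩ <;> simp [entryLE]

theorem entryLE_trans {e₁ e₂ e₃ : Entry V} (h : entryLE e₁ e₂) (h' : entryLE e₂ e₃) :
    entryLE e₁ e₃ := by
  rcases e₁ with _ | ⟨v₁, t₁⟩ <;> rcases e₂ with _ | ⟨v₂, t₂⟩ <;> rcases e₃ with _ | ⟨v₃, t₃⟩ <;>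
    simp_all [entryLE]
  exact h.trans h'

theorem exists_ge_of_entryLE {e e' : Entry V} (h : entryLE e e') {t : ℤ} (ht : t ∈ entryTs e) :
    ∃ t' ∈ entryTs e', t ≤ t' := by
  obtain ⟨v, rfl⟩ := ht
  rcases e' with _ | ⟨v', t'⟩
  · exact h.elim
  · exact ⟨t', ⟨v', rfl⟩, h⟩

theorem IsMaxEntry.left_le {e₁ e₂ e : Entry V} (h : IsMaxEntry {e₁, e₂} e) : entryLE e₁ e :=
  h.2 _ (by simp)

theorem IsMaxEntry.right_le {e₁ e₂ e : Entry V} (h : IsMaxEntry {e₁, e₂} e) : entryLE e₂ e :=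
  h.2 _ (by simp)

theorem IsMaxEntry.mem_entryTs {e₁ e₂ e : Entry V} (h : IsMaxEntry {e₁, e₂} e) {t : ℤ}
    (ht : t ∈ entryTs e) : t ∈ entryTs e₁ ∨ t ∈ entryTs e₂ := by
  rcases h.1 with rfl | rfl
  exacts [.inl ht, .inr ht]

theorem Merge.reg_le {i : Fin n} {Rec : Set (Reg n V)} {ts ts' : ℤ} {reg reg' : Reg n V}
    (h : Merge i Rec ts reg ts' reg') (k : Fin n) : entryLE (reg k) (reg' k) :=
  (h.2 k).2 _ (by simp)

theorem Merge.mem_entryTs {i : Fin n} {Rec : Set (Reg n V)} {ts ts' : ℤ} {reg reg' : Reg n V}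
    (h : Merge i Rec ts reg ts' reg') {k : Fin n} {t : ℤ} (ht : t ∈ entryTs (reg' k)) :
    t ∈ entryTs (reg k) ∨ ∃ r ∈ Rec, t ∈ entryTs (r k) := by
  rcases (h.2 k).1 with h1 | ⟨r, hr, h1⟩
  · rw [Set.mem_singleton_iff.1 h1] at ht
    exact .inl ht
  · exact .inr ⟨r, hr, (show r k = reg' k from h1) ▸ ht⟩

theorem Merge.ts_le {i : Fin n} {Rec : Set (Reg n V)} {ts ts' : ℤ} {reg reg' : Reg n V}
    (h : Merge i Rec ts reg ts' reg') : ts ≤ ts' :=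
  h.1.2 (by simp)

theorem Merge.le_ts {i : Fin n} {Rec : Set (Reg n V)} {ts ts' : ℤ} {reg reg' : Reg n V}
    (h : Merge i Rec ts reg ts' reg') {t : ℤ} (ht : t ∈ entryTs (reg' i)) : t ≤ ts' := by
  refine h.1.2 ?_
  rcases h.mem_entryTs ht with h1 | ⟨r, hr, h1⟩
  · exact .inl (.inr h1)
  · exact .inr (Set.mem_biUnion hr h1)

@[simp] theorem State.setNode_node (c : State n V) (i : Fin n) (nd : Node n V) :
    (c.setNode i nd).node = Function.update c.node i nd := rfl

@[simp] theorem State.setNode_chan (c : State n V) (i : Fin n) (nd : Node n V) :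
    (c.setNode i nd).chan = c.chan := rfl

@[simp] theorem State.setChan_node (c : State n V) (i j : Fin n) (ch : Multiset (Packet n V)) :
    (c.setChan i j ch).node = c.node := rfl

theorem State.setChan_chan (c : State n V) (i j : Fin n) (ch : Multiset (Packet n V))
    (i' j' : Fin n) :
    (c.setChan i j ch).chan i' j' = if i' = i ∧ j' = j then ch else c.chan i' j' := by
  by_cases hi : i' = i
  · subst hi
    by_cases hj : j' = j
    · subst hj; simp [State.setChan]
    · simp [State.setChan, hj]
  · simp [State.setChan, hi]

/-! ### Channels -/

section Channel

variable {c c' : State n V} {a : Act n V} {i j i' j' : Fin n} {m : Msg n V} {p : Packet n V}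

theorem Sends.node_eq (h : Sends cap x i j m c c') : c'.node = c.node := by
  obtain ⟨ch, -, rfl⟩ := h
  rfl

theorem Sends.mem (h : Sends cap x i j m c c') : (⟨m, x + 1⟩ : Packet n V) ∈ c'.chan i j := by
  obtain ⟨ch, h, rfl⟩ := h
  rw [State.setChan_chan, if_pos ⟨rfl, rfl⟩]
  rcases h with ⟨-, rfl⟩ | ⟨-, q, rest, -, rfl⟩ <;> simp

open Classical in
theorem Sends.count_le (h : Sends cap x i j m c c') (hp : p ≠ ⟨m, x + 1⟩) :
    (c'.chan i' j').count p ≤ (c.chan i' j').count p := by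
  obtain ⟨ch, h, rfl⟩ := h
  rw [State.setChan_chan]
  split_ifs with hij
  · obtain ⟨rfl, rfl⟩ := hij
    rcases h with ⟨-, rfl⟩ | ⟨-, q, rest, hc, rfl⟩
    · rw [Multiset.count_cons_of_ne hp]
    · rw [Multiset.count_cons_of_ne hp, hc]
      exact Multiset.count_le_count_cons _ _ _
  · rfl

theorem Sends.mem_chan (h : Sends cap x i j m c c') (hp : p ∈ c'.chan i' j') :
    p ∈ c.chan i' j' ∨ (i' = i ∧ j' = j ∧ p = ⟨m, x + 1⟩) := by
  obtain ⟨ch, h, rfl⟩ := h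
  rw [State.setChan_chan] at hp
  split_ifs at hp with hij
  · obtain ⟨rfl, rfl⟩ := hij
    rcases h with ⟨-, rfl⟩ | ⟨-, q, rest, hc, rfl⟩
    · rcases Multiset.mem_cons.1 hp with rfl | hp
      · exact .inr ⟨rfl, rfl, rfl⟩
      · exact .inl hp
    · rcases Multiset.mem_cons.1 hp with rfl | hp
      · exact .inr ⟨rfl, rfl, rfl⟩
      · exact .inl (hc ▸ Multiset.mem_cons_of_mem hp)
  · exact .inl hp

theorem subset_of_eq_cons {α : Type*} {b : α} {s t : Multiset α} (h : s = b ::ₘ t) : t ⊆ s :=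
  h ▸ Multiset.subset_cons t b

theorem mem_chan_of_mem_setChan {ch : Multiset (Packet n V)} (hch : ch ⊆ c.chan i j)
    (hp : p ∈ (c.setChan i j ch).chan i' j') : p ∈ c.chan i' j' := by
  rw [State.setChan_chan] at hp
  split_ifs at hp with hij
  · obtain ⟨rfl, rfl⟩ := hij
    exact hch hp
  · exact hp

/-- The step labelled `a` from `c` to `c'` sends this message from node `i` to node `j`. -/
inductive Emits (c : State n V) (a : Act n V) (c' : State n V) (i j : Fin n) : Msg n V → Prop
  | gossip (ha : a = .loop i) (hij : j ≠ i) : Emits c a c' i j (.gossip ((c.node i).reg j))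
  | write (lReg : Reg n V) (acks : Multiset (Fin n × Reg n V)) (ha : a = .client i) (hij : j ≠ i)
      (hc : (c.node i).client = .write lReg j acks) : Emits c a c' i j (.write lReg)
  | snapshot (prev out : Reg n V) (acks : Multiset (Fin n × Reg n V × ℤ)) (ha : a = .client i)
      (hij : j ≠ i) (hc : (c.node i).client = .snapshot prev out j acks) :
      Emits c a c' i j (.snapshot out (c.node i).ssn)
  | writeAck (p : Packet n V) (r : Reg n V) (ha : a = .deliver j i p) (hp : p ∈ c.chan j i)
      (hm : p.msg = .write r) (hr : regLE r (c'.node i).reg) :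
      Emits c a c' i j (.writeAck (c'.node i).reg)
  | snapshotAck (p : Packet n V) (r : Reg n V) (s : ℤ) (ha : a = .deliver j i p)
      (hp : p ∈ c.chan j i) (hm : p.msg = .snapshot r s) :
      Emits c a c' i j (.snapshotAck (c'.node i).reg s)

/-- Loss, overwriting and duplication bring in no packet that was absent, so every new packet is
traced to its sender. -/
theorem Step.mem_chan (h : Step cap x c a c') (hp : p ∈ c'.chan i j) :
    p ∈ c.chan i j ∨ (p.sentAt = x + 1 ∧ Emits c a c' i j p.msg) := by
  cases h with
  | loopFirst | loopSkip | loopEnd | invokeWrite | invokeSnapshot | writeSelf | writeRetry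
  | writeReturn | snapSelf | snapRetry | snapReturn | snapAgain => exact .inl hp
  | loopGossip c' i₀ k hpc hk hs =>
    rcases hs.mem_chan hp with hp | ⟨rfl, rfl, rfl⟩
    · exact .inl hp
    · exact .inr ⟨rfl, .gossip rfl hk⟩
  | writeSend c' i₀ k lReg acks hc hk hs =>
    rcases hs.mem_chan hp with hp | ⟨rfl, rfl, rfl⟩
    · exact .inl hp
    · exact .inr ⟨rfl, .write lReg acks rfl hk hc⟩
  | snapSend c' i₀ k prev out acks hc hk hs =>
    rcases hs.mem_chan hp with hp | ⟨rfl, rfl, rfl⟩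
    · exact .inl hp
    · exact .inr ⟨rfl, .snapshot prev out acks rfl hk hc⟩
  | writeArrival c' j₀ i₀ q rest r reg' hch hq hr hs =>
    rcases hs.mem_chan hp with hp | ⟨rfl, rfl, rfl⟩
    · exact .inl (mem_chan_of_mem_setChan (subset_of_eq_cons hch) hp)
    · have : (c'.node i).reg = reg' := by simp [hs.node_eq]
      refine .inr ⟨rfl, this ▸ .writeAck q r rfl (by simp [hch]) hq ?_⟩
      exact fun k => this ▸ (hr k).right_le
  | snapArrival c' j₀ i₀ q rest r reg' s hch hq hr hs =>
    rcases hs.mem_chan hp with hp | ⟨rfl, rfl, rfl⟩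
    · exact .inl (mem_chan_of_mem_setChan (subset_of_eq_cons hch) hp)
    · have : (c'.node i).reg = reg' := by simp [hs.node_eq]
      exact .inr ⟨rfl, this ▸ .snapshotAck q r s rfl (by simp [hch]) hq⟩
  | gossipArrival | writeAckAccept | writeAckIgnore | snapAckAccept | snapAckIgnore | lose =>
    have hch := ‹c.chan _ _ = _›
    exact .inl (mem_chan_of_mem_setChan (subset_of_eq_cons hch) hp)
  | duplicate j₀ i₀ q hq =>
    exact .inl (mem_chan_of_mem_setChan (Multiset.cons_subset.2 ⟨hq, fun _ h => h⟩) hp)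

end Channel

/-! ### Quorum accesses -/

/-- The messages that the ongoing operation broadcasts. -/
def Node.Request (nd : Node n V) : Msg n V → Prop :=
  match nd.client with
  | .idle => fun _ => False
  | .write lReg _ _ => fun m => m = .write lReg
  | .snapshot _ _ _ _ => fun m => ∃ r, m = .snapshot r nd.ssn

/-- The messages that the ongoing operation waits for. -/
def Node.Reply (nd : Node n V) : Msg n V → Prop :=
  match nd.client with
  | .idle => fun _ => False
  | .write lReg _ _ => fun m => ∃ r, m = .writeAck r ∧ regLE lReg r
  | .snapshot _ _ _ _ => fun m => ∃ r, m = .snapshotAck r nd.ssn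

/-- The ongoing operation has stored an acknowledgment of node `j` that it waits for. -/
def Node.Acked (nd : Node n V) (j : Fin n) : Prop :=
  match nd.client with
  | .idle => False
  | .write lReg _ acks => ∃ r, (j, r) ∈ acks ∧ regLE lReg r
  | .snapshot _ _ _ acks => ∃ r, (j, r, nd.ssn) ∈ acks

theorem Node.quorumReached_of_acked {nd : Node n V} (i : Fin n) (hd : n ≤ nd.client.dest)
    (h : ∀ j, nd.Acked j) : nd.QuorumReached := by
  -- The node `i` serves only to exclude `n = 0`, where no majority exists.
  have hn : n < 2 * n := by have := i.pos; omega
  unfold Node.Acked at h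
  unfold Node.QuorumReached
  rcases hc : nd.client with _ | ⟨lReg, d, acks⟩ | ⟨prev, out, d, acks⟩ <;> simp only [hc] at h hd ⊢
  · exact h i
  · refine ⟨hd, ?_⟩
    have : {j : Fin n | ∃ r, (j, r) ∈ acks ∧ regLE lReg r} = Set.univ := Set.eq_univ_of_forall h
    simpa [WriteQuorum, this, Set.ncard_univ] using hn
  · refine ⟨hd, ?_⟩
    have : {j : Fin n | ∃ r, (j, r, nd.ssn) ∈ acks} = Set.univ := Set.eq_univ_of_forall h
    simpa [SnapQuorum, this, Set.ncard_univ] using hn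

/-! ### The effect of a step on the local state of one node -/

/-- The step labelled `a` from `c` changes the local state of node `i` to the given one. -/
inductive NodeStep (c : State n V) (a : Act n V) (i : Fin n) : Node n V → Prop
  | same (hl : a ≠ .loop i) (hc : a ≠ .client i)
      (hd : ∀ j p, a = .deliver j i p → p.msg.kind ≠ .gossip ∧ ¬ (c.node i).Reply p.msg) :
      NodeStep c a i (c.node i)
  | loopFirst (ts' : ℤ) (ha : a = .loop i) (hpc : (c.node i).pc = 0)
      (hts : IsGreatest ({(c.node i).ts} ∪ entryTs ((c.node i).reg i)) ts') :
      NodeStep c a i { c.node i with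
        ts := ts', pc := 1, client := (c.node i).client.deleteStale (c.node i).ssn }
  | loopNext (ha : a = .loop i) (h0 : (c.node i).pc ≠ 0) (hpc : (c.node i).pc ≤ n) :
      NodeStep c a i { c.node i with pc := (c.node i).pc + 1 }
  | loopEnd (ha : a = .loop i) (hpc : n < (c.node i).pc) :
      NodeStep c a i { c.node i with pc := 0 }
  | invokeWrite (v : V) (reg' : Reg n V) (ha : a = .invokeWrite i v)
      (hc : (c.node i).client = .idle)
      (hr : reg' = Function.update (c.node i).reg i (some (v, (c.node i).ts + 1))) :
      NodeStep c a i { c.node i with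
        ts := (c.node i).ts + 1, reg := reg', client := .write reg' 0 0 }
  | writeSend (k : Fin n) (lReg : Reg n V) (acks : Multiset (Fin n × Reg n V))
      (ha : a = .client i) (hc : (c.node i).client = .write lReg k acks) (hk : k ≠ i) :
      NodeStep c a i { c.node i with client := .write lReg (k + 1) acks }
  | writeSelf (lReg reg' : Reg n V) (acks : Multiset (Fin n × Reg n V)) (ha : a = .client i)
      (hc : (c.node i).client = .write lReg i acks) (hr : MaxReg (c.node i).reg lReg reg') :
      NodeStep c a i { c.node i with
        reg := reg', client := .write lReg (i + 1) ((i, reg') ::ₘ acks) }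
  | writeRetry (lReg : Reg n V) (d : ℕ) (acks : Multiset (Fin n × Reg n V)) (ha : a = .client i)
      (hc : (c.node i).client = .write lReg d acks) (hd : n ≤ d) (hq : ¬ WriteQuorum lReg acks) :
      NodeStep c a i { c.node i with client := .write lReg 0 acks }
  | writeReturn (lReg : Reg n V) (d : ℕ) (acks : Multiset (Fin n × Reg n V)) (ts' : ℤ)
      (reg' : Reg n V) (ha : a = .client i) (hc : (c.node i).client = .write lReg d acks)
      (hd : n ≤ d) (hq : WriteQuorum lReg acks)
      (hm : Merge i (writeRec lReg acks) (c.node i).ts (c.node i).reg ts' reg') :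
      NodeStep c a i { c.node i with ts := ts', reg := reg', client := .idle }
  | invokeSnapshot (ha : a = .invokeSnapshot i) (hc : (c.node i).client = .idle) :
      NodeStep c a i { c.node i with
        ssn := (c.node i).ssn + 1, client := .snapshot (c.node i).reg (c.node i).reg 0 0 }
  | snapSend (k : Fin n) (prev out : Reg n V) (acks : Multiset (Fin n × Reg n V × ℤ))
      (ha : a = .client i) (hc : (c.node i).client = .snapshot prev out k acks) (hk : k ≠ i) :
      NodeStep c a i { c.node i with client := .snapshot prev out (k + 1) acks }
  | snapSelf (prev out reg' : Reg n V) (acks : Multiset (Fin n × Reg n V × ℤ))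
      (ha : a = .client i) (hc : (c.node i).client = .snapshot prev out i acks)
      (hr : MaxReg (c.node i).reg out reg') :
      NodeStep c a i { c.node i with
        reg := reg'
        client := .snapshot prev out (i + 1) ((i, reg', (c.node i).ssn) ::ₘ acks) }
  | snapRetry (prev out : Reg n V) (d : ℕ) (acks : Multiset (Fin n × Reg n V × ℤ))
      (ha : a = .client i) (hc : (c.node i).client = .snapshot prev out d acks) (hd : n ≤ d)
      (hq : ¬ SnapQuorum (c.node i).ssn acks) :
      NodeStep c a i { c.node i with client := .snapshot prev (c.node i).reg 0 acks }
  | snapReturn (prev out : Reg n V) (d : ℕ) (acks : Multiset (Fin n × Reg n V × ℤ)) (ts' : ℤ)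
      (reg' : Reg n V) (ha : a = .client i) (hc : (c.node i).client = .snapshot prev out d acks)
      (hd : n ≤ d) (hq : SnapQuorum (c.node i).ssn acks)
      (hm : Merge i (snapRec (c.node i).ssn acks) (c.node i).ts (c.node i).reg ts' reg') :
      NodeStep c a i { c.node i with ts := ts', reg := reg', client := .idle }
  | snapAgain (prev out : Reg n V) (d : ℕ) (acks : Multiset (Fin n × Reg n V × ℤ)) (ts' : ℤ)
      (reg' : Reg n V) (ha : a = .client i) (hc : (c.node i).client = .snapshot prev out d acks)
      (hd : n ≤ d) (hq : SnapQuorum (c.node i).ssn acks)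
      (hm : Merge i (snapRec (c.node i).ssn acks) (c.node i).ts (c.node i).reg ts' reg') :
      NodeStep c a i { c.node i with
        ts := ts', reg := reg', ssn := (c.node i).ssn + 1, client := .snapshot reg' reg' 0 0 }
  | gossipArrival (j : Fin n) (p : Packet n V) (e e' : Entry V) (ts' : ℤ) (ha : a = .deliver j i p)
      (hch : p ∈ c.chan j i) (hp : p.msg = .gossip e)
      (he : IsMaxEntry {(c.node i).reg i, e} e')
      (hts : IsGreatest ({(c.node i).ts} ∪ entryTs e') ts') :
      NodeStep c a i { c.node i with ts := ts', reg := Function.update (c.node i).reg i e' }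
  | requestArrival (j : Fin n) (p : Packet n V) (r reg' : Reg n V) (ha : a = .deliver j i p)
      (hch : p ∈ c.chan j i) (hp : p.msg = .write r ∨ ∃ s, p.msg = .snapshot r s)
      (hr : MaxReg (c.node i).reg r reg') :
      NodeStep c a i { c.node i with reg := reg' }
  | writeAckAccept (j : Fin n) (p : Packet n V) (r lReg : Reg n V) (d : ℕ)
      (acks : Multiset (Fin n × Reg n V)) (ha : a = .deliver j i p) (hch : p ∈ c.chan j i)
      (hp : p.msg = .writeAck r) (hc : (c.node i).client = .write lReg d acks)
      (hr : regLE lReg r) :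
      NodeStep c a i { c.node i with client := .write lReg d ((j, r) ::ₘ acks) }
  | snapAckAccept (j : Fin n) (p : Packet n V) (r prev out : Reg n V) (d : ℕ)
      (acks : Multiset (Fin n × Reg n V × ℤ)) (ha : a = .deliver j i p) (hch : p ∈ c.chan j i)
      (hp : p.msg = .snapshotAck r (c.node i).ssn)
      (hc : (c.node i).client = .snapshot prev out d acks) :
      NodeStep c a i { c.node i with
        client := .snapshot prev out d ((j, r, (c.node i).ssn) ::ₘ acks) }

section

variable {c c' : State n V} {a : Act n V} {i j : Fin n} {nd : Node n V}

theorem NodeStep.update {i₀ : Fin n} (h : NodeStep c a i₀ nd)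
    (hl : ∀ i ≠ i₀, a ≠ .loop i) (hc : ∀ i ≠ i₀, a ≠ .client i)
    (hd : ∀ i ≠ i₀, ∀ j p, a ≠ .deliver j i p) (i : Fin n) :
    NodeStep c a i (Function.update c.node i₀ nd i) := by
  rcases eq_or_ne i i₀ with rfl | hi
  · simpa using h
  · rw [Function.update_of_ne hi]
    exact .same (hl i hi) (hc i hi) fun j p hp => (hd i hi j p hp).elim

/-- Projects a global step to one node. Among the arrivals only ignored acknowledgments leave the
receiver unchanged, which is why `same` can promise that neither gossip nor an awaited reply was
delivered. -/
theorem Step.nodeStep (h : Step cap x c a c') (i : Fin n) : NodeStep c a i (c'.node i) := by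
  cases h
  case lose => exact .same (by simp) (by simp) (by simp)
  case duplicate => exact .same (by simp) (by simp) (by simp)
  case writeAckIgnore j i₀ p rest r hch hp hc =>
    refine .same (by simp) (by simp) ?_
    rintro _ _ ⟨⟩
    refine ⟨by simp [hp, Msg.kind], fun h => ?_⟩
    unfold Node.Reply at h
    rcases hcl : (c.node i).client with _ | ⟨lReg, d, acks⟩ | ⟨prev, out, d, acks⟩ <;>
      simp only [hcl, hp] at h
    · obtain ⟨r', hr, hle⟩ := h
      cases hr
      exact hc _ _ _ hcl hle
    · simp at h
  case snapAckIgnore j i₀ p rest r s hch hp hc =>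
    refine .same (by simp) (by simp) ?_
    rintro _ _ ⟨⟩
    refine ⟨by simp [hp, Msg.kind], fun h => ?_⟩
    unfold Node.Reply at h
    rcases hcl : (c.node i).client with _ | ⟨lReg, d, acks⟩ | ⟨prev, out, d, acks⟩ <;>
      simp only [hcl, hp] at h
    · simp at h
    · obtain ⟨r', hr⟩ := h
      cases hr
      exact hc _ _ _ _ hcl rfl
  all_goals try rw [Sends.node_eq ‹Sends _ _ _ _ _ _ _›]
  all_goals
    refine NodeStep.update ?_ (fun k hk => by simp [hk.symm]) (fun k hk => by simp [hk.symm])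
      (fun k hk => by simp [hk.symm]) i
  case loopFirst i₀ ts' hpc hts => exact .loopFirst ts' rfl hpc hts
  case loopGossip i₀ k hpc hk hs =>
    simpa [hpc] using NodeStep.loopNext (c := c) (i := i₀) rfl (by omega) (by omega)
  case loopSkip i₀ hpc =>
    simpa [hpc] using NodeStep.loopNext (c := c) (i := i₀) rfl (by omega) (by omega)
  case loopEnd i₀ hpc => exact .loopEnd rfl hpc
  case invokeWrite i₀ v reg' hc hr => exact .invokeWrite v reg' rfl hc hr
  case writeSend i₀ k lReg acks hc hk hs => exact .writeSend k lReg acks rfl hc hk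
  case writeSelf i₀ lReg reg' acks hc hr => exact .writeSelf lReg reg' acks rfl hc hr
  case writeRetry i₀ lReg d acks hc hd hq => exact .writeRetry lReg d acks rfl hc hd hq
  case writeReturn i₀ lReg d acks ts' reg' hc hd hq hm =>
    exact .writeReturn lReg d acks ts' reg' rfl hc hd hq hm
  case invokeSnapshot i₀ hc => exact .invokeSnapshot rfl hc
  case snapSend i₀ k prev out acks hc hk hs => exact .snapSend k prev out acks rfl hc hk
  case snapSelf i₀ prev out reg' acks hc hr => exact .snapSelf prev out reg' acks rfl hc hr
  case snapRetry i₀ prev out d acks hc hd hq => exact .snapRetry prev out d acks rfl hc hd hq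
  case snapReturn i₀ prev out d acks ts' reg' hc hd hq hm hp =>
    exact .snapReturn prev out d acks ts' reg' rfl hc hd hq hm
  case snapAgain i₀ prev out d acks ts' reg' hc hd hq hm hp =>
    exact .snapAgain prev out d acks ts' reg' rfl hc hd hq hm
  case gossipArrival j i₀ p rest e e' ts' hch hp he hts =>
    exact .gossipArrival j p e e' ts' rfl (by simp [hch]) hp he hts
  case writeArrival j i₀ p rest r reg' hch hp hr hs =>
    exact .requestArrival j p r reg' rfl (by simp [hch]) (.inl hp) hr
  case snapArrival j i₀ p rest r reg' s hch hp hr hs =>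
    exact .requestArrival j p r reg' rfl (by simp [hch]) (.inr ⟨s, hp⟩) hr
  case writeAckAccept j i₀ p rest r lReg d acks hch hp hc hr =>
    exact .writeAckAccept j p r lReg d acks rfl (by simp [hch]) hp hc hr
  case snapAckAccept j i₀ p rest r prev out d acks hch hp hc =>
    exact .snapAckAccept j p r prev out d acks rfl (by simp [hch]) hp hc

end

/-! ### Timestamps and sequence numbers in the local state, and how one step changes them. -/

/-- The timestamps of node `i` in the arrays that the ongoing operation sends or compares. -/
def Client.reqTs (i : Fin n) : Client n V → Set ℤ
  | .idle => ∅
  | .write lReg _ _ => entryTs (lReg i)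
  | .snapshot prev out _ _ => entryTs (prev i) ∪ entryTs (out i)

/-- The timestamps of node `i` in the stored acknowledgments. -/
def Client.ackTs (i : Fin n) : Client n V → Set ℤ
  | .idle => ∅
  | .write _ _ acks => {t | ∃ a ∈ acks, t ∈ entryTs (a.2 i)}
  | .snapshot _ _ _ acks => {t | ∃ a ∈ acks, t ∈ entryTs (a.2.1 i)}

/-- The snapshot sequence numbers of the stored acknowledgments. -/
def Client.ackSsn : Client n V → Set ℤ
  | .snapshot _ _ _ acks => {s | ∃ a ∈ acks, s = a.2.2}
  | _ => ∅

theorem Client.tsOf_eq (i : Fin n) (cl : Client n V) : cl.tsOf i = cl.reqTs i ∪ cl.ackTs i := by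
  cases cl <;> simp [Client.tsOf, Client.reqTs, Client.ackTs]

@[simp] theorem Client.reqTs_deleteStale (i : Fin n) (s : ℤ) (cl : Client n V) :
    (cl.deleteStale s).reqTs i = cl.reqTs i := by
  cases cl <;> rfl

theorem Client.ackTs_deleteStale (i : Fin n) (s : ℤ) (cl : Client n V) :
    (cl.deleteStale s).ackTs i ⊆ cl.ackTs i := by
  cases cl
  case snapshot =>
    rintro t ⟨a, ha, ht⟩
    exact ⟨a, (Multiset.mem_filter.1 ha).1, ht⟩
  all_goals exact subset_rfl

theorem Client.ackSsn_deleteStale {s t : ℤ} {cl : Client n V} (h : t ∈ (cl.deleteStale s).ackSsn) :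
    t = s := by
  cases cl
  case snapshot =>
    obtain ⟨a, ha, rfl⟩ := h
    exact (Multiset.mem_filter.1 ha).2
  all_goals exact h.elim

/-- In the step labelled `a` from `c`, node `i` is not waiting for a majority afterwards, or starts
a new wait. -/
def Fresh (c : State n V) (a : Act n V) (i : Fin n) : Prop :=
  (c.node i).client = .idle ∨ (a = .client i ∧ (c.node i).QuorumReached)

section

variable {c : State n V} {a : Act n V} {i j k : Fin n} {nd : Node n V}

theorem NodeStep.ts_le (h : NodeStep c a i nd) : (c.node i).ts ≤ nd.ts := by
  cases h with
  | loopFirst ts' ha hpc hts => exact hts.2 (by simp)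
  | gossipArrival j p e e' ts' ha hch hp he hts => exact hts.2 (by simp)
  | writeReturn lReg d acks ts' reg' ha hc hd hq hm => exact hm.ts_le
  | snapReturn prev out d acks ts' reg' ha hc hd hq hm => exact hm.ts_le
  | snapAgain prev out d acks ts' reg' ha hc hd hq hm => exact hm.ts_le
  | _ => simp

theorem NodeStep.ssn_le (h : NodeStep c a i nd) : (c.node i).ssn ≤ nd.ssn := by
  cases h <;> simp

/-- Every update of `reg` is a maximum except the assignment in `write`, which may lower the own
entry when `ts` lags behind it. -/
theorem NodeStep.reg_le (h : NodeStep c a i nd) (hk : k = i → ∀ v, a ≠ .invokeWrite i v) :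
    entryLE ((c.node i).reg k) (nd.reg k) := by
  cases h with
  | invokeWrite v reg' ha hc hr =>
    have hki : k ≠ i := fun hki => hk hki v ha
    simpa [hr, hki] using entryLE_refl _
  | gossipArrival j p e e' ts' ha hch hp he hts =>
    rcases eq_or_ne k i with rfl | hki
    · simpa using he.left_le
    · simpa [hki] using entryLE_refl _
  | writeReturn lReg d acks ts' reg' ha hc hd hq hm => exact hm.reg_le k
  | snapReturn prev out d acks ts' reg' ha hc hd hq hm => exact hm.reg_le k
  | snapAgain prev out d acks ts' reg' ha hc hd hq hm => exact hm.reg_le k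
  | writeSelf lReg reg' acks ha hc hr => exact (hr k).left_le
  | snapSelf prev out reg' acks ha hc hr => exact (hr k).left_le
  | requestArrival j p r reg' ha hch hp hr => exact (hr k).left_le
  | _ => exact entryLE_refl _

theorem not_fresh {cl : Client n V} (hcl : (c.node i).client = cl) (h : cl ≠ .idle)
    (hq : a = .client i → ¬ (c.node i).QuorumReached) : ¬ Fresh c a i := by
  rintro (h' | ⟨h₁, h₂⟩)
  exacts [h (hcl ▸ h'), hq h₁ h₂]

/-- The timestamps in the arrays of the operation were there before the step, or are those of the
node's own array. -/
theorem NodeStep.mem_reqTs (h : NodeStep c a i nd) {k : Fin n} {t : ℤ}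
    (ht : t ∈ nd.client.reqTs k) :
    t ∈ entryTs (nd.reg k) ∨ (t ∈ (c.node i).client.reqTs k ∧ ¬ Fresh c a i) := by
  have key : ∀ {cl : Client n V}, (c.node i).client = cl →
      (a = .client i → ¬ (c.node i).QuorumReached) → t ∈ cl.reqTs k →
      t ∈ (c.node i).client.reqTs k ∧ ¬ Fresh c a i := by
    intro cl hcl h1 h2
    refine ⟨hcl ▸ h2, not_fresh hcl ?_ h1⟩
    rintro rfl
    exact h2
  cases h with
  | same hl hc hd => exact .inr (key rfl (fun h => (hc h).elim) ht)
  | loopFirst ts' ha hpc hts =>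
    exact .inr (key rfl (by simp [ha]) (by rwa [Client.reqTs_deleteStale] at ht))
  | loopNext ha | loopEnd ha | gossipArrival j p e e' ts' ha | requestArrival j p r reg' ha =>
    exact .inr (key rfl (by simp [ha]) ht)
  | invokeWrite => exact .inl ht
  | writeReturn | snapReturn => exact ht.elim
  | invokeSnapshot | snapAgain => exact .inl (by simpa [Client.reqTs] using ht)
  | writeSend k' lReg acks ha hc | writeSelf lReg reg' acks ha hc | snapSend k' prev out acks ha hc
  | snapSelf prev out reg' acks ha hc =>
    exact .inr (key hc (fun _ => by simp [Node.QuorumReached, hc]) ht)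
  | writeRetry lReg d acks ha hc hd hq =>
    exact .inr (key hc (fun _ => by simp [Node.QuorumReached, hc, hq]) ht)
  | snapRetry prev out d acks ha hc hd hq =>
    -- A retry keeps `prev` but refreshes `out` from the current `reg`.
    rcases ht with ht | ht
    · exact .inr (key hc (fun _ => by simp [Node.QuorumReached, hc, hq]) (.inl ht))
    · exact .inl ht
  | writeAckAccept j p r lReg d acks ha hch hp hc | snapAckAccept j p r prev out d acks ha hch hp hc =>
    exact .inr (key hc (by simp [ha]) ht)

/-- The timestamps in the stored acknowledgments were there before the step, or are those of the
node's own array, or of a message that arrives. -/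
theorem NodeStep.mem_ackTs (h : NodeStep c a i nd) {k : Fin n} {t : ℤ}
    (ht : t ∈ nd.client.ackTs k) :
    (t ∈ (c.node i).client.ackTs k ∧ ¬ Fresh c a i) ∨ t ∈ entryTs (nd.reg k) ∨
      ∃ j, ∃ p ∈ c.chan j i, t ∈ p.msg.tsOf k i := by
  have key : ∀ {cl : Client n V}, (c.node i).client = cl →
      (a = .client i → ¬ (c.node i).QuorumReached) → t ∈ cl.ackTs k →
      t ∈ (c.node i).client.ackTs k ∧ ¬ Fresh c a i := by
    intro cl hcl h1 h2
    refine ⟨hcl ▸ h2, not_fresh hcl ?_ h1⟩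
    rintro rfl
    exact h2
  cases h with
  | same hl hc hd => exact .inl (key rfl (fun h => (hc h).elim) ht)
  | loopFirst ts' ha hpc hts =>
    exact .inl (key rfl (by simp [ha]) (Client.ackTs_deleteStale _ _ _ ht))
  | loopNext ha | loopEnd ha | gossipArrival j p e e' ts' ha | requestArrival j p r reg' ha =>
    exact .inl (key rfl (by simp [ha]) ht)
  | writeReturn | snapReturn => exact ht.elim
  | invokeWrite | invokeSnapshot | snapAgain => simp [Client.ackTs] at ht
  | writeSend k' lReg acks ha hc | snapSend k' prev out acks ha hc =>
    exact .inl (key hc (fun _ => by simp [Node.QuorumReached, hc]) ht)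
  | writeRetry lReg d acks ha hc hd hq | snapRetry prev out d acks ha hc hd hq =>
    exact .inl (key hc (fun _ => by simp [Node.QuorumReached, hc, hq]) ht)
  | writeSelf lReg reg' acks ha hc | snapSelf prev out reg' acks ha hc =>
    obtain ⟨b, hb, ht⟩ := ht
    rcases Multiset.mem_cons.1 hb with rfl | hb
    · exact .inr (.inl ht)
    · exact .inl (key hc (fun _ => by simp [Node.QuorumReached, hc]) ⟨b, hb, ht⟩)
  | writeAckAccept j p r lReg d acks ha hch hp hc | snapAckAccept j p r prev out d acks ha hch hp hc =>
    obtain ⟨b, hb, ht⟩ := ht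
    rcases Multiset.mem_cons.1 hb with rfl | hb
    · exact .inr (.inr ⟨j, p, hch, by rw [hp]; exact ht⟩)
    · exact .inl (key hc (by simp [ha]) ⟨b, hb, ht⟩)

/-- The timestamps in the array of a node: those of other nodes' entries may come from
acknowledgments, and those of its own entry are taken into account by `ts` in this case. -/
theorem NodeStep.mem_reg (h : NodeStep c a i nd) {k : Fin n} {t : ℤ}
    (ht : t ∈ entryTs (nd.reg k)) :
    t ∈ entryTs ((c.node i).reg k) ∨ t ∈ (c.node i).client.reqTs k ∨
      (∃ j, ∃ p ∈ c.chan j i, t ∈ p.msg.tsOf k i) ∨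
      (k ≠ i ∧ t ∈ (c.node i).client.ackTs k) ∨ (k = i ∧ t ≤ nd.ts) := by
  cases h with
  | invokeWrite v reg' ha hc hr =>
    subst hr
    rcases eq_or_ne k i with rfl | hk
    · obtain ⟨v', hv⟩ := ht
      simp at hv
      simp [hv.2]
    · exact .inl (by simpa [hk] using ht)
  | writeReturn lReg d acks ts' reg' ha hc hd hq hm =>
    by_cases hk : k = i
    · subst hk; exact .inr (.inr (.inr (.inr ⟨rfl, hm.le_ts ht⟩)))
    rcases hm.mem_entryTs ht with ht | ⟨r, ⟨j, hr, -⟩, ht⟩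
    · exact .inl ht
    · exact .inr (.inr (.inr (.inl ⟨hk, by rw [hc]; exact ⟨_, hr, ht⟩⟩)))
  | snapReturn prev out d acks ts' reg' ha hc hd hq hm
  | snapAgain prev out d acks ts' reg' ha hc hd hq hm =>
    by_cases hk : k = i
    · subst hk; exact .inr (.inr (.inr (.inr ⟨rfl, hm.le_ts ht⟩)))
    rcases hm.mem_entryTs ht with ht | ⟨r, ⟨j, hr⟩, ht⟩
    · exact .inl ht
    · exact .inr (.inr (.inr (.inl ⟨hk, by rw [hc]; exact ⟨_, hr, ht⟩⟩)))
  | writeSelf lReg reg' acks ha hc hr =>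
    exact (hr k).mem_entryTs ht |>.imp id fun ht => .inl (by rw [hc]; exact ht)
  | snapSelf prev out reg' acks ha hc hr =>
    exact (hr k).mem_entryTs ht |>.imp id fun ht => .inl (by rw [hc]; exact .inr ht)
  | gossipArrival j p e e' ts' ha hch hp he hts =>
    rcases eq_or_ne k i with rfl | hk
    · simp only [Function.update_self] at ht
      exact .inr (.inr (.inr (.inr ⟨rfl, hts.2 (.inr ht)⟩)))
    · exact .inl (by simpa [hk] using ht)
  | requestArrival j p r reg' ha hch hp hr =>
    refine (hr k).mem_entryTs ht |>.imp id fun ht => .inr (.inl ⟨j, p, hch, ?_⟩)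
    rcases hp with hp | ⟨s, hp⟩ <;> rw [hp] <;> exact ht
  | _ => exact .inl ht

/-- An acknowledgment is stored only with the current `ssn`, and the first line of the loop leaves
no other number in the store. Older excess numbers can therefore survive any step but that one. -/
theorem NodeStep.mem_ackSsn (h : NodeStep c a i nd) {s : ℤ} (hs : s ∈ nd.client.ackSsn) :
    (s ∈ (c.node i).client.ackSsn ∧ ¬ (a = .loop i ∧ (c.node i).pc = 0)) ∨ s ≤ nd.ssn := by
  cases h with
  | same hl => exact .inl ⟨hs, fun h => hl h.1⟩
  | loopFirst => exact .inr (Client.ackSsn_deleteStale hs).le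
  | loopNext ha h0 => exact .inl ⟨hs, fun h => h0 h.2⟩
  | loopEnd ha h0 => exact .inl ⟨hs, fun h => by omega⟩
  | gossipArrival j p e e' ts' ha | requestArrival j p r reg' ha =>
    exact .inl ⟨hs, by simp [ha]⟩
  | invokeWrite | writeSend | writeSelf | writeRetry | writeReturn | snapReturn
  | writeAckAccept => exact hs.elim
  | invokeSnapshot | snapAgain => simp [Client.ackSsn] at hs
  | snapSend k' prev out acks ha hc | snapRetry prev out d acks ha hc =>
    exact .inl ⟨by rw [hc]; exact hs, by simp [ha]⟩
  | snapSelf prev out reg' acks ha hc | snapAckAccept j p r prev out d acks ha hch hp hc =>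
    obtain ⟨b, hb, rfl⟩ := hs
    rcases Multiset.mem_cons.1 hb with rfl | hb
    · exact .inr le_rfl
    · exact .inl ⟨by rw [hc]; exact ⟨b, hb, rfl⟩, by simp [ha]⟩

theorem NodeStep.reg_le_ts_of_loopFirst (h : NodeStep c a i nd) (ha : a = .loop i)
    (hpc : (c.node i).pc = 0) {t : ℤ} (ht : t ∈ entryTs (nd.reg i)) : t ≤ nd.ts := by
  subst ha
  cases h with
  | same hl => exact (hl rfl).elim
  | loopFirst ts' ha hpc hts => exact hts.2 (.inr ht)
  | loopNext ha h0 => exact (h0 hpc).elim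
  | loopEnd ha h0 => omega
  | _ => simp_all

theorem NodeStep.le_ts_of_gossip (h : NodeStep c a i nd) {p : Packet n V} {e : Entry V}
    (ha : a = .deliver j i p) (hp : p.msg = .gossip e) {t : ℤ} (ht : t ∈ entryTs e) :
    t ≤ nd.ts := by
  subst ha
  cases h with
  | same hl hc hd => exact ((hd j p rfl).1 (by rw [hp]; rfl)).elim
  | gossipArrival j p e' e'' ts' ha hch hp' he hts =>
    cases ha
    cases hp.symm.trans hp'
    -- The entry kept need not be `e`, but its timestamp is at least as large and `ts` is raised to
    -- it.
    obtain ⟨t', ht', hle⟩ := exists_ge_of_entryLE he.right_le ht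
    exact hle.trans (hts.2 (.inr ht'))
  | _ => simp_all

/-! ### The program counter of the do-forever loop. -/

theorem NodeStep.pc_eq (h : NodeStep c a i nd) (ha : a ≠ .loop i) : nd.pc = (c.node i).pc := by
  cases h <;> first | rfl | contradiction

theorem NodeStep.pc_succ (h : NodeStep c a i nd) (ha : a = .loop i) (hpc : (c.node i).pc ≤ n) :
    nd.pc = (c.node i).pc + 1 := by
  subst ha
  cases h with
  | same hl => exact (hl rfl).elim
  | loopFirst ts' ha hpc => simp [hpc]
  | loopNext => rfl
  | loopEnd => omega
  | _ => simp_all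

theorem NodeStep.pc_zero (h : NodeStep c a i nd) (ha : a = .loop i) (hpc : n < (c.node i).pc) :
    nd.pc = 0 := by
  subst ha
  cases h with
  | same hl => exact (hl rfl).elim
  | loopFirst ts' ha hpc => omega
  | loopNext => omega
  | loopEnd => rfl
  | _ => simp_all

/-! ### Steps during a quorum access -/

/-- During one access `lReg` and `ssn` do not change, although the array in a `SNAPSHOT` may. The
loop deletes only acknowledgments with a different number, so those that count are kept. -/
theorem NodeStep.access (h : NodeStep c a i nd) (hf : ¬ Fresh c a i) :
    nd.client ≠ .idle ∧ nd.Request = (c.node i).Request ∧ nd.Reply = (c.node i).Reply ∧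
      ∀ j, (c.node i).Acked j → nd.Acked j := by
  have hidle : (c.node i).client ≠ .idle := fun h => hf (.inl h)
  have hquor : a = .client i → ¬ (c.node i).QuorumReached := fun h1 h2 => hf (.inr ⟨h1, h2⟩)
  unfold Node.Request Node.Reply Node.Acked
  unfold Node.QuorumReached at hquor
  cases h with
  | same | loopNext | loopEnd | gossipArrival | requestArrival => exact ⟨hidle, rfl, rfl, fun _ => id⟩
  | loopFirst =>
    rcases hcl : (c.node i).client with _ | ⟨lReg, d, acks⟩ | ⟨prev, out, d, acks⟩
    · exact (hidle hcl).elim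
    · simp [Client.deleteStale]
    · simp [Client.deleteStale]
  | invokeWrite v reg' ha hc | invokeSnapshot ha hc => exact (hidle hc).elim
  | writeReturn lReg d acks ts' reg' ha hc hd hq
  | snapReturn prev out d acks ts' reg' ha hc hd hq
  | snapAgain prev out d acks ts' reg' ha hc hd hq =>
    simp [hc, hd, hq, ha] at hquor
  | writeSend k' lReg acks ha hc | snapSend k' prev out acks ha hc
  | writeRetry lReg d acks ha hc hd hq | snapRetry prev out d acks ha hc hd hq =>
    simp [hc]
  | writeSelf lReg reg' acks ha hc | snapSelf prev out reg' acks ha hc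
  | writeAckAccept j p r lReg d acks ha hch hp hc
  | snapAckAccept j p r prev out d acks ha hch hp hc =>
    simp only [hc, Multiset.mem_cons]
    exact ⟨by simp, trivial, trivial, fun j hj => by grind⟩

/-- With the next two lemmas: during an access the broadcast position is a counter driven by the
client steps, in the form that `exists_counter_eq` asks for. -/
theorem NodeStep.dest_eq (h : NodeStep c a i nd) (hf : ¬ Fresh c a i) (ha : a ≠ .client i) :
    nd.client.dest = (c.node i).client.dest := by
  have hidle : (c.node i).client ≠ .idle := fun h => hf (.inl h)
  cases h with
  | loopFirst =>
    rcases hcl : (c.node i).client with _ | ⟨lReg, d, acks⟩ | ⟨prev, out, d, acks⟩ <;> rfl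
  | invokeWrite v reg' ha hc | invokeSnapshot ha hc => exact (hidle hc).elim
  | writeAckAccept j p r lReg d acks ha hch hp hc
  | snapAckAccept j p r prev out d acks ha hch hp hc => simp [hc, Client.dest]
  | _ => first | rfl | contradiction

theorem NodeStep.dest_succ (h : NodeStep c a i nd) (hf : ¬ Fresh c a i) (ha : a = .client i)
    (hd : (c.node i).client.dest < n) : nd.client.dest = (c.node i).client.dest + 1 := by
  subst ha
  cases h with
  | same hl hc => exact (hc rfl).elim
  | writeSend k' lReg acks ha hc | snapSend k' prev out acks ha hc
  | writeSelf lReg reg' acks ha hc | snapSelf prev out reg' acks ha hc => simp [hc, Client.dest]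
  | writeRetry lReg d acks ha hc hd' hq | snapRetry prev out d acks ha hc hd' hq
  | writeReturn lReg d acks ts' reg' ha hc hd'
  | snapReturn prev out d acks ts' reg' ha hc hd'
  | snapAgain prev out d acks ts' reg' ha hc hd' =>
    simp [hc, Client.dest] at hd
    omega
  | _ => simp_all

theorem NodeStep.dest_zero (h : NodeStep c a i nd) (hf : ¬ Fresh c a i) (ha : a = .client i)
    (hd : n ≤ (c.node i).client.dest) : nd.client.dest = 0 := by
  have hquor : a = .client i → ¬ (c.node i).QuorumReached := fun h1 h2 => hf (.inr ⟨h1, h2⟩)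
  unfold Node.QuorumReached at hquor
  subst ha
  cases h with
  | same hl hc => exact (hc rfl).elim
  | writeSend k' lReg acks ha hc | snapSend k' prev out acks ha hc
  | writeSelf lReg reg' acks ha hc | snapSelf prev out reg' acks ha hc =>
    simp [hc, Client.dest] at hd
    omega
  | writeRetry | snapRetry => rfl
  | writeReturn lReg d acks ts' reg' ha hc hd' hq
  | snapReturn prev out d acks ts' reg' ha hc hd' hq
  | snapAgain prev out d acks ts' reg' ha hc hd' hq =>
    simp [hc, hd', hq] at hquor
  | _ => simp_all

/-- A node that sends its request to itself acknowledges it in the same step. -/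
theorem NodeStep.acked_self (h : NodeStep c a i nd) (hf : ¬ Fresh c a i) (ha : a = .client i)
    (hd : (c.node i).client.dest = i) : nd.Acked i := by
  subst ha
  unfold Node.Acked
  cases h with
  | same hl hc => exact (hc rfl).elim
  | writeSend k' lReg acks ha hc hk | snapSend k' prev out acks ha hc hk =>
    simp only [hc, Client.dest] at hd
    exact (hk (Fin.ext hd)).elim
  | writeSelf lReg reg' acks ha hc hr =>
    exact ⟨reg', by simp, fun k => (hr k).right_le⟩
  | snapSelf prev out reg' acks ha hc => exact ⟨reg', by simp⟩
  | writeRetry lReg d acks ha hc hd' hq | snapRetry prev out d acks ha hc hd' hq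
  | writeReturn lReg d acks ts' reg' ha hc hd'
  | snapReturn prev out d acks ts' reg' ha hc hd'
  | snapAgain prev out d acks ts' reg' ha hc hd' =>
    simp only [hc, Client.dest] at hd
    omega
  | _ => simp_all

theorem NodeStep.acked_of_deliver (h : NodeStep c a i nd) {p : Packet n V}
    (ha : a = .deliver j i p) (hp : (c.node i).Reply p.msg) : nd.Acked j := by
  subst ha
  unfold Node.Acked
  cases h with
  | same hl hc hd => exact ((hd j p rfl).2 hp).elim
  | gossipArrival j p e e' ts' ha hch hm =>
    cases ha
    unfold Node.Reply at hp
    rcases hcl : (c.node i).client with _ | ⟨lReg, d, acks⟩ | ⟨prev, out, d, acks⟩ <;> simp_all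
  | requestArrival j p r reg' ha hch hm =>
    cases ha
    unfold Node.Reply at hp
    rcases hcl : (c.node i).client with _ | ⟨lReg, d, acks⟩ | ⟨prev, out, d, acks⟩ <;>
      rcases hm with hm | ⟨s, hm⟩ <;> simp_all
  | writeAckAccept j p r lReg d acks ha hch hp hc hr =>
    cases ha
    exact ⟨r, by simp, hr⟩
  | snapAckAccept j p r prev out d acks ha hch hp hc =>
    cases ha
    exact ⟨r, by simp⟩
  | _ => simp_all

end

/-! ### The effect of a step on channels: copies of a packet, deliveries and sends. -/

section

variable {c c' : State n V} {a : Act n V} {i j k : Fin n} {p : Packet n V}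

theorem Step.chan_self (h : Step cap x c a c') (hc : ∀ i, c.chan i i = 0) (i : Fin n) :
    c'.chan i i = 0 := by
  refine Multiset.eq_zero_of_forall_notMem fun p hp => ?_
  have hno : ∀ q, q ∉ c.chan i i := fun q hq => by simp [hc i] at hq
  rcases h.mem_chan hp with hp | ⟨-, he⟩
  · exact hno p hp
  · generalize p.msg = m at he
    cases he with
    | gossip ha hij | write lReg acks ha hij | snapshot prev out acks ha hij => exact hij rfl
    | writeAck q r ha hq | snapshotAck q r s ha hq => exact hno q hq

open Classical in
theorem count_setChan_le {q : Packet n V} {rest : Multiset (Packet n V)}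
    (h : c.chan j i = q ::ₘ rest) {i' j' : Fin n} :
    ((c.setChan j i rest).chan i' j').count p ≤ (c.chan i' j').count p := by
  rw [State.setChan_chan]
  split_ifs with hij
  · obtain ⟨rfl, rfl⟩ := hij
    exact h ▸ Multiset.count_le_count_cons _ _ _
  · rfl

open Classical in
theorem count_setChan_lt {rest : Multiset (Packet n V)} (h : c.chan j i = p ::ₘ rest) :
    ((c.setChan j i rest).chan j i).count p < (c.chan j i).count p := by
  rw [State.setChan_chan, if_pos ⟨rfl, rfl⟩, h, Multiset.count_cons_self]
  exact Nat.lt_succ_self _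

open Classical in
-- Since a packet sent in step `x` has label `x + 1`, an older packet can gain copies only by
-- duplication.
theorem Step.count_le (h : Step cap x c a c') (hp : p.sentAt ≠ x + 1)
    (ha : a ≠ .duplicate i j p) : (c'.chan i j).count p ≤ (c.chan i j).count p := by
  have hne : ∀ m, p ≠ ⟨m, x + 1⟩ := fun m h => hp (by rw [h])
  cases h with
  | loopFirst | loopSkip | loopEnd | invokeWrite | invokeSnapshot | writeSelf | writeRetry
  | writeReturn | snapSelf | snapRetry | snapReturn | snapAgain => exact le_rfl
  | loopGossip c' i₀ k hpc hk hs => exact hs.count_le (hne _)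
  | writeSend c' i₀ k lReg acks hc hk hs => exact hs.count_le (hne _)
  | snapSend c' i₀ k prev out acks hc hk hs => exact hs.count_le (hne _)
  | writeArrival c' j₀ i₀ q rest r reg' hch hq hr hs =>
    exact (hs.count_le (hne _)).trans (count_setChan_le hch)
  | snapArrival c' j₀ i₀ q rest r reg' s hch hq hr hs =>
    exact (hs.count_le (hne _)).trans (count_setChan_le hch)
  | gossipArrival | writeAckAccept | writeAckIgnore | snapAckAccept | snapAckIgnore | lose =>
    exact count_setChan_le ‹c.chan _ _ = _›
  | duplicate j₀ i₀ q hq =>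
    rw [State.setChan_chan]
    split_ifs with hij
    · obtain ⟨rfl, rfl⟩ := hij
      rw [Multiset.count_cons_of_ne]
      rintro rfl
      exact ha rfl
    · rfl

open Classical in
theorem Step.count_lt (h : Step cap x c (.deliver i j p) c') (hp : p.sentAt ≠ x + 1) :
    (c'.chan i j).count p < (c.chan i j).count p := by
  have hne : ∀ m, p ≠ ⟨m, x + 1⟩ := fun m h => hp (by rw [h])
  cases h with
  | writeArrival _ _ _ _ rest r reg' hch hq hr hs =>
    exact (hs.count_le (hne _)).trans_lt (count_setChan_lt hch)
  | snapArrival _ _ _ _ rest r reg' s hch hq hr hs =>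
    exact (hs.count_le (hne _)).trans_lt (count_setChan_lt hch)
  | gossipArrival | writeAckAccept | writeAckIgnore | snapAckAccept | snapAckIgnore =>
    exact count_setChan_lt ‹c.chan _ _ = _›

theorem Step.mem_of_deliver (h : Step cap x c (.deliver i j p) c') : p ∈ c.chan i j := by
  cases h <;> simp [*]

theorem Step.sends_gossip (h : Step cap x c (.loop i) c') (hpc : (c.node i).pc = j + 1)
    (hij : j ≠ i) : ∃ m : Msg n V, m.kind = .gossip ∧ (⟨m, x + 1⟩ : Packet n V) ∈ c'.chan i j := by
  cases h with
  | loopFirst _ _ h0 => omega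
  | loopGossip _ _ k hk hki hs =>
    obtain rfl : k = j := Fin.ext (by omega)
    exact ⟨_, rfl, hs.mem⟩
  | loopSkip _ h0 => exact (hij (Fin.ext (by omega))).elim
  | loopEnd _ h0 => omega

theorem Step.sends_request (h : Step cap x c (.client i) c') (hd : (c.node i).client.dest = j)
    (hij : j ≠ i) : ∃ m : Msg n V, (c.node i).Request m ∧ (⟨m, x + 1⟩ : Packet n V) ∈ c'.chan i j := by
  unfold Node.Request
  cases h with
  | writeSend c' i k lReg acks hc hk hs =>
    obtain rfl : k = j := Fin.ext (by simpa [hc, Client.dest] using hd)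
    exact ⟨_, by simp [hc], hs.mem⟩
  | snapSend c' i k prev out acks hc hk hs =>
    obtain rfl : k = j := Fin.ext (by simpa [hc, Client.dest] using hd)
    exact ⟨_, by simp [hc], hs.mem⟩
  | writeSelf i lReg reg' acks hc =>
    exact (hij (Fin.ext (by simpa [hc, Client.dest] using hd.symm))).elim
  | snapSelf i prev out reg' acks hc =>
    exact (hij (Fin.ext (by simpa [hc, Client.dest] using hd.symm))).elim
  | _ =>
    have hc := ‹(c.node _).client = _›
    simp only [hc, Client.dest] at hd
    omega

theorem Step.sends_writeAck (h : Step cap x c (.deliver j i p) c') (hp : p.msg.kind = .write) :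
    ∃ m : Msg n V, m.kind = .writeAck ∧ (⟨m, x + 1⟩ : Packet n V) ∈ c'.chan i j := by
  cases h with
  | writeArrival _ _ _ _ rest r reg' hch hq hr hs => exact ⟨_, rfl, hs.mem⟩
  | _ => simp_all [Msg.kind]

theorem Step.sends_snapshotAck (h : Step cap x c (.deliver j i p) c')
    (hp : p.msg.kind = .snapshot) :
    ∃ m : Msg n V, m.kind = .snapshotAck ∧ (⟨m, x + 1⟩ : Packet n V) ∈ c'.chan i j := by
  cases h with
  | snapArrival _ _ _ _ rest r reg' s hch hq hr hs => exact ⟨_, rfl, hs.mem⟩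
  | _ => simp_all [Msg.kind]

end

/-! ### Counters that run through a loop -/

/-- A counter that is increased at the times in `E`, and reset to `0` at such times once it
exceeds `N`, takes each small value at infinitely many times in `E`. -/
theorem exists_counter_eq {f : ℕ → ℕ} {E : ℕ → Prop} {N x₀ : ℕ}
    (hE : ∃ᶠ x in atTop, E x) (h₀ : ∀ x ≥ x₀, ¬ E x → f (x + 1) = f x)
    (h₁ : ∀ x ≥ x₀, E x → f x < N → f (x + 1) = f x + 1)
    (h₂ : ∀ x ≥ x₀, E x → N ≤ f x → f (x + 1) = 0) {v : ℕ} (hv : v ≤ N) (x : ℕ) :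
    ∃ y ≥ x, E y ∧ (f y = v ∨ (v = N ∧ N ≤ f y)) := by
  -- The counter is constant up to the first event after `x`.
  have next : ∀ x ≥ x₀, ∃ y ≥ x, E y ∧ f y = f x := by
    intro x hx
    obtain ⟨y, hy, hEy⟩ := (frequently_atTop.1 hE) x
    induction y using Nat.strong_induction_on with
    | _ y ih =>
      by_cases h : ∃ z, x ≤ z ∧ z < y ∧ E z
      · obtain ⟨z, hxz, hzy, hz⟩ := h
        exact ih z hzy hxz hz
      · push Not at h
        refine ⟨y, hy, hEy, ?_⟩
        clear ih hEy
        induction y, hy using Nat.le_induction with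
        | base => rfl
        | succ y hy ih =>
          rw [h₀ y (hx.trans hy) (h y hy (Nat.lt_succ_self y))]
          exact ih fun z hz hzy => h z hz (hzy.trans (Nat.lt_succ_self y))
  -- Induction on a bound `k` for the distance to `N`. The start is arbitrary, so the counter may
  -- already exceed `N`; hence only `N ≤ f y` is claimed.
  have up : ∀ k, ∀ x ≥ x₀, N ≤ f x + k → ∃ y ≥ x, E y ∧ N ≤ f y := by
    intro k
    induction k with
    | zero =>
      intro x hx hk
      obtain ⟨y, hy, hEy, hf⟩ := next x hx
      exact ⟨y, hy, hEy, by omega⟩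
    | succ k ih =>
      intro x hx hk
      obtain ⟨y, hy, hEy, hf⟩ := next x hx
      by_cases hN : N ≤ f y
      · exact ⟨y, hy, hEy, hN⟩
      · have := h₁ y (hx.trans hy) hEy (by omega)
        obtain ⟨z, hz, h⟩ := ih (y + 1) (by omega) (by omega)
        exact ⟨z, by omega, h⟩
  have small : ∀ v < N, ∀ x ≥ x₀, ∃ y ≥ x, E y ∧ f y = v := by
    intro v
    induction v with
    | zero =>
      intro _ x hx
      obtain ⟨y, hy, hEy, hf⟩ := up N x hx (by omega)
      have h0 := h₂ y (hx.trans hy) hEy hf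
      obtain ⟨z, hz, hEz, hf'⟩ := next (y + 1) (by omega)
      exact ⟨z, by omega, hEz, by omega⟩
    | succ v ih =>
      intro hv x hx
      obtain ⟨y, hy, hEy, hf⟩ := ih (by omega) x hx
      have h0 := h₁ y (hx.trans hy) hEy (by omega)
      obtain ⟨z, hz, hEz, hf'⟩ := next (y + 1) (by omega)
      exact ⟨z, by omega, hEz, by omega⟩
  rcases hv.lt_or_eq with hv | rfl
  · obtain ⟨y, hy, h, h'⟩ := small v hv (max x x₀) (le_max_right _ _)
    exact ⟨y, (le_max_left _ _).trans hy, h, .inl h'⟩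
  · obtain ⟨y, hy, h, h'⟩ := up v (max x x₀) (le_max_right _ _) (by omega)
    exact ⟨y, (le_max_left _ _).trans hy, h, .inr ⟨rfl, h'⟩⟩

/-- A sequence of natural numbers that eventually does not increase cannot decrease infinitely
often. -/
theorem not_frequently_lt {f : ℕ → ℕ} (h : ∀ᶠ x in atTop, f (x + 1) ≤ f x) :
    ¬ ∃ᶠ x in atTop, f (x + 1) < f x := by
  intro hlt
  obtain ⟨x₀, h⟩ := eventually_atTop.1 h
  have anti : ∀ x ≥ x₀, ∀ y ≥ x, f y ≤ f x := by
    intro x hx y hy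
    induction y, hy using Nat.le_induction with
    | base => rfl
    | succ y hy ih => exact (h y (hx.trans hy)).trans ih
  have key : ∀ m, ∀ x ≥ x₀, f x ≠ m := by
    intro m
    induction m using Nat.strong_induction_on with
    | _ m ih =>
      rintro x hx rfl
      obtain ⟨y, hy, hlt⟩ := (frequently_atTop.1 hlt) x
      exact ih _ (hlt.trans_le (anti x hx y hy)) (y + 1) (by omega) rfl
  exact key _ x₀ le_rfl rfl

/-! ### Tracing packets along an execution by their labels. -/

namespace Execution

variable {R : Execution n cap V} {i j : Fin n} {p : Packet n V} {b s y z e u : ℕ}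

theorem chan_self (R : Execution n cap V) (x : ℕ) : ∀ i, (R.c x).chan i i = 0 := by
  induction x with
  | zero => exact R.init_self
  | succ x ih => exact (R.step x).chan_self ih

theorem sentAt_le (hp : p ∈ (R.c x).chan i j) : p.sentAt ≤ x := by
  induction x with
  | zero => exact (R.init_label i j p hp).le
  | succ x ih =>
    rcases (R.step x).mem_chan hp with hp | ⟨hp, -⟩
    · exact (ih hp).trans (Nat.le_succ x)
    · exact hp.le

/-- Packets that enter a channel after `c x` have labels above `x`, so an older one has been there
since. -/
theorem mem_chan_of_sentAt_le (hp : p ∈ (R.c z).chan i j) (hxz : x ≤ z) (hx : p.sentAt ≤ x) :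
    p ∈ (R.c x).chan i j := by
  induction z, hxz using Nat.le_induction with
  | base => exact hp
  | succ z hxz ih =>
    rcases (R.step z).mem_chan hp with hp | ⟨hp, -⟩
    · exact ih hp
    · omega

theorem emits_of_mem (hp : p ∈ (R.c z).chan i j) (hs : x < p.sentAt) :
    ∃ s, x ≤ s ∧ s < z ∧ p.sentAt = s + 1 ∧ Emits (R.c s) (R.a s) (R.c (s + 1)) i j p.msg := by
  obtain ⟨s, hps⟩ : ∃ s, p.sentAt = s + 1 := ⟨p.sentAt - 1, by omega⟩
  have hsz := sentAt_le hp
  have hp' := mem_chan_of_sentAt_le hp (x := s + 1) (by omega) hps.le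
  rcases (R.step s).mem_chan hp' with hp | ⟨-, he⟩
  -- Impossible: no packet in `c s` has label `s + 1`.
  · have := sentAt_le hp
    omega
  · exact ⟨s, by omega, by omega, hps, he⟩

theorem mem_chan_of_deliver (h : R.a x = .deliver i j p) : p ∈ (R.c x).chan i j :=
  Step.mem_of_deliver (h ▸ R.step x)

/-! ### Old packets disappear -/

open Classical in
-- A packet in transit infinitely often would be delivered infinitely often. Each delivery removes a
-- copy, while copies eventually stop being added.
theorem Fair.eventually_notMem (hF : R.Fair) (i j : Fin n) (p : Packet n V) :
    ∀ᶠ z in atTop, p ∉ (R.c z).chan i j := by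
  by_contra hcon
  have hdel := hF.receive i j p (by simpa [Filter.Frequently] using hcon)
  have hlabel : ∀ᶠ z in atTop, p.sentAt ≠ z + 1 :=
    (eventually_ge_atTop p.sentAt).mono fun z hz => by omega
  refine not_frequently_lt (f := fun z => ((R.c z).chan i j).count p) ?_ ?_
  · filter_upwards [hlabel, hF.duplication i j p] with z h1 h2
    exact (R.step z).count_le h1 h2
  · exact (hdel.and_eventually hlabel).mono fun z ⟨h1, h2⟩ => Step.count_lt (h1 ▸ R.step z) h2

open Classical in
theorem Fair.eventually_lt_sentAt (hF : R.Fair) (i j : Fin n) (b : ℕ) :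
    ∀ᶠ z in atTop, ∀ p ∈ (R.c z).chan i j, b < p.sentAt := by
  have h : ∀ᶠ z in atTop, ∀ p ∈ ((R.c b).chan i j).toFinset, p ∉ (R.c z).chan i j :=
    (eventually_all_finset _).2 fun p _ => hF.eventually_notMem i j p
  filter_upwards [h, eventually_ge_atTop b] with z hz hbz p hp
  by_contra hlt
  exact hz p (Multiset.mem_toFinset.2 (mem_chan_of_sentAt_le hp hbz (not_lt.1 hlt))) hp

/-! ### Nodes keep running -/

theorem Fair.exists_loop (hF : R.Fair) (i : Fin n) {v : ℕ} (hv : v ≤ n + 1) (x : ℕ) :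
    ∃ y ≥ x, R.a y = .loop i ∧
      (((R.c y).node i).pc = v ∨ (v = n + 1 ∧ n + 1 ≤ ((R.c y).node i).pc)) :=
  exists_counter_eq (f := fun x => ((R.c x).node i).pc) (x₀ := 0) (hF.loop i)
    (fun x _ h => ((R.step x).nodeStep i).pc_eq h)
    (fun x _ h h' => ((R.step x).nodeStep i).pc_succ h (by omega))
    (fun x _ h h' => ((R.step x).nodeStep i).pc_zero h (by omega)) hv x

theorem Fair.gossip (hF : R.Fair) (hij : j ≠ i) (y : ℕ) :
    ∃ x p, y ≤ x ∧ R.a x = .deliver i j p ∧ p.msg.kind = .gossip := by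
  have hfreq : ∃ᶠ x in atTop, ∃ m : Msg n V, m.kind = .gossip ∧
      (⟨m, x + 1⟩ : Packet n V) ∈ (R.c (x + 1)).chan i j := by
    refine frequently_atTop.2 fun y => ?_
    obtain ⟨x, hx, ha, hpc | ⟨hpc, -⟩⟩ := hF.exists_loop i (v := j + 1) (by omega) y
    · exact ⟨x, hx, Step.sends_gossip (ha ▸ R.step x) hpc hij⟩
    · omega
  obtain ⟨x, p, h1, h2, h3, -⟩ := hF.comm i j .gossip hfreq y
  exact ⟨x, p, h1, h2, h3⟩

/-- During an unbounded quorum access, requests keep completing round-trips. -/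
theorem Fair.exists_roundTrip (hF : R.Fair)
    (hf : ∀ z ≥ b, ¬ Fresh (R.c z) (R.a z) i) (j : Fin n) :
    ∃ s u, b ≤ s ∧ R.RoundTrip i j s u := by
  have hclient : ∃ᶠ x in atTop, R.a x = .client i :=
    hF.client i ((eventually_ge_atTop b).mono fun z hz h => hf z hz (.inl h)).frequently
  have hdest : ∀ x, ∃ y ≥ x, R.a y = .client i ∧ ((R.c y).node i).client.dest = j := by
    intro x
    obtain ⟨y, hy, ha, h | ⟨h, -⟩⟩ :=
      exists_counter_eq (f := fun x => ((R.c x).node i).client.dest) (x₀ := b) (N := n) (v := j)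
        hclient (fun x hx h => ((R.step x).nodeStep i).dest_eq (hf x hx) h)
        (fun x hx h h' => ((R.step x).nodeStep i).dest_succ (hf x hx) h h')
        (fun x hx h h' => ((R.step x).nodeStep i).dest_zero (hf x hx) h h') (by omega) x
    · exact ⟨y, hy, ha, h⟩
    · omega
  rcases eq_or_ne j i with rfl | hij
  · obtain ⟨y, hy, ha, h⟩ := hdest b
    exact ⟨y, y, hy, ha, .inl ⟨rfl, h, rfl⟩⟩
  have hreq : ∀ z ≥ b, ((R.c z).node i).Request = ((R.c b).node i).Request := by
    intro z hz
    induction z, hz using Nat.le_induction with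
    | base => rfl
    | succ z hz ih => rw [(((R.step z).nodeStep i).access (hf z hz)).2.1, ih]
  -- Fair communication is per kind. The request is fixed during the access, so all its broadcasts
  -- have one kind `κ`, answered by messages of kind `κ'`.
  obtain ⟨κ, κ', hκ, hkind⟩ : ∃ κ κ' : Kind,
      (κ = .write ∧ κ' = .writeAck ∨ κ = .snapshot ∧ κ' = .snapshotAck) ∧
      ∀ m, ((R.c b).node i).Request m → m.kind = κ := by
    unfold Node.Request
    rcases ((R.c b).node i).client with _ | ⟨lReg, d, acks⟩ | ⟨prev, out, d, acks⟩
    · exact ⟨.write, .writeAck, by simp, fun m h => h.elim⟩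
    · exact ⟨.write, .writeAck, by simp, fun m h => h ▸ rfl⟩
    · refine ⟨.snapshot, .snapshotAck, by simp, ?_⟩
      rintro m ⟨r, rfl⟩
      rfl
  have hsend : ∃ᶠ x in atTop, ∃ m : Msg n V, m.kind = κ ∧
      (⟨m, x + 1⟩ : Packet n V) ∈ (R.c (x + 1)).chan i j := by
    refine frequently_atTop.2 fun x => ?_
    obtain ⟨y, hy, ha, hd⟩ := hdest (max x b)
    obtain ⟨m, hm, hmem⟩ := Step.sends_request (ha ▸ R.step y) hd hij
    rw [hreq y (le_of_max_le_right hy)] at hm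
    exact ⟨y, le_of_max_le_left hy, m, hkind m hm, hmem⟩
  have hreply : ∃ᶠ x in atTop, ∃ m : Msg n V, m.kind = κ' ∧
      (⟨m, x + 1⟩ : Packet n V) ∈ (R.c (x + 1)).chan j i := by
    refine frequently_atTop.2 fun y => ?_
    obtain ⟨x, p, hx, ha, hp, -⟩ := hF.comm i j κ hsend y
    refine ⟨x, hx, ?_⟩
    rcases hκ with ⟨rfl, rfl⟩ | ⟨rfl, rfl⟩
    · exact Step.sends_writeAck (ha ▸ R.step x) hp
    · exact Step.sends_snapshotAck (ha ▸ R.step x) hp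
  -- From `T` on, every packet from `i` to `j` was sent after `c b`. A reply sent after `c T` thus
  -- answers a request of the present access, and the round-trip is read backwards from its arrival.
  obtain ⟨T, hT⟩ := eventually_atTop.1 (hF.eventually_lt_sentAt i j b)
  obtain ⟨u, q, -, hau, hq, hqT⟩ := hF.comm j i κ' hreply T
  obtain ⟨t, htT, -, hqt, hem⟩ := emits_of_mem (mem_chan_of_deliver hau) hqT
  obtain ⟨p, hat, hp, hpk⟩ : ∃ p, R.a t = .deliver i j p ∧ p ∈ (R.c t).chan i j ∧
      p.msg.kind = κ := by
    generalize q.msg = m at hem hq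
    cases hem with
    | gossip | write | snapshot => rcases hκ with ⟨rfl, rfl⟩ | ⟨rfl, rfl⟩ <;> simp [Msg.kind] at hq
    | writeAck p r ha hp hm =>
      refine ⟨p, ha, hp, ?_⟩
      rcases hκ with ⟨rfl, rfl⟩ | ⟨rfl, rfl⟩
      · rw [hm]; rfl
      · simp [Msg.kind] at hq
    | snapshotAck p r s ha hp hm =>
      refine ⟨p, ha, hp, ?_⟩
      rcases hκ with ⟨rfl, rfl⟩ | ⟨rfl, rfl⟩
      · simp [Msg.kind] at hq
      · rw [hm]; rfl
  obtain ⟨s, hbs, -, hps, hem⟩ := emits_of_mem hp (hT t htT p hp)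
  have has : R.a s = .client i := by
    generalize p.msg = m at hem hpk
    cases hem with
    | write lReg acks ha | snapshot prev out acks ha => exact ha
    | _ => rcases hκ with ⟨rfl, rfl⟩ | ⟨rfl, rfl⟩ <;> simp [Msg.kind] at hpk
  exact ⟨s, u, hbs, has, .inr ⟨hij, t, p, q, hps, hat, hqt, hau⟩⟩

/-- An operation becomes idle only by ending its access, so the idle alternative of `Fresh` cannot
arise. -/
theorem not_fresh_of_not_endsAccess (hs : ((R.c s).node i).client ≠ .idle)
    (h : ∀ x, s ≤ x → x < e → ¬ R.EndsAccess i x) (hx : s ≤ x) (hxe : x < e) :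
    ¬ Fresh (R.c x) (R.a x) i := by
  have hidle : ((R.c x).node i).client ≠ .idle := by
    induction x, hx using Nat.le_induction with
    | base => exact hs
    | succ x hx ih =>
      refine (((R.step x).nodeStep i).access ?_).1
      rintro (h' | h')
      exacts [ih (by omega) h', h x hx (by omega) h']
  rintro (h' | h')
  exacts [hidle h', h x hx hxe h']

/-- Either accesses end infinitely often, and the waiting clause is void for late `e`, or from some
point on none ends, and a pending one completes round-trips with all nodes. Having all late `e` lets
the finitely many nodes share one endpoint. -/
theorem Fair.exists_iteration (hF : R.Fair) (i : Fin n) (x : ℕ) :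
    ∃ b ≥ x, ∀ᶠ e in atTop, R.Iteration i b e := by
  classical
  obtain ⟨x₀, hx₀, hcase⟩ : ∃ x₀ ≥ x, (∃ᶠ z in atTop, R.EndsAccess i z) ∨
      ∀ z ≥ x₀, ¬ R.EndsAccess i z := by
    by_cases h : ∃ᶠ z in atTop, R.EndsAccess i z
    · exact ⟨x, le_rfl, .inl h⟩
    · obtain ⟨x₀, h⟩ := eventually_atTop.1 (not_frequently.1 h)
      exact ⟨max x x₀, le_max_left _ _, .inr fun z hz => h z (le_of_max_le_right hz)⟩
  obtain ⟨b, hb, hab, hpcb⟩ := hF.exists_loop i (v := 0) (by omega) x₀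
  have hpcb : ((R.c b).node i).pc = 0 := by omega
  have hex : ∃ d, b < d ∧ R.a d = .loop i ∧ n < ((R.c d).node i).pc := by
    obtain ⟨d, hd, had, hpcd⟩ := hF.exists_loop i (v := n + 1) le_rfl (b + 1)
    exact ⟨d, hd, had, by omega⟩
  obtain ⟨hbd, had, hpcd⟩ := Nat.find_spec hex
  have hmin := fun m => Nat.find_min hex (m := m)
  set d := Nat.find hex
  refine ⟨b, hx₀.trans hb, ?_⟩
  have hwait : ∀ᶠ e in atTop, ((R.c d).node i).client ≠ .idle →
      (∀ x, d ≤ x → x < e → ¬ R.EndsAccess i x) →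
      ∀ j, ∃ s u, b ≤ s ∧ u < e ∧ R.RoundTrip i j s u ∧ ∀ x, s ≤ x → x < e → ¬ R.EndsAccess i x := by
    rcases hcase with hfreq | hnever
    · obtain ⟨z, hz, hends⟩ := frequently_atTop.1 hfreq d
      filter_upwards [eventually_gt_atTop z] with e he _ h
      exact (h z hz he hends).elim
    · by_cases hidle : ((R.c d).node i).client = .idle
      · exact Eventually.of_forall fun e h => (h hidle).elim
      have hrt := fun j => hF.exists_roundTrip (b := d) (i := i) (fun z hz =>
        not_fresh_of_not_endsAccess hidle (e := z + 1)
          (fun x hx _ => hnever x (by omega)) hz (Nat.lt_succ_self z)) j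
      choose s u hs hrt using hrt
      have hu : ∀ᶠ e in atTop, ∀ j, u j < e := eventually_all.2 fun j => eventually_gt_atTop (u j)
      filter_upwards [hu] with e he _ _ j
      have := hs j
      exact ⟨s j, u j, by omega, he j, hrt j, fun x hx _ => hnever x (by omega)⟩
  have hgossip : ∀ᶠ e in atTop, ∀ j, j ≠ i →
      ∃ x p, b ≤ x ∧ x < e ∧ R.a x = .deliver i j p ∧ p.msg.kind = .gossip := by
    refine eventually_all.2 fun j => ?_
    by_cases hij : j = i
    · exact Eventually.of_forall fun e h => (h hij).elim
    · obtain ⟨x, p, hx, ha, hp⟩ := hF.gossip hij b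
      filter_upwards [eventually_gt_atTop x] with e he _
      exact ⟨x, p, hx, he, ha, hp⟩
  filter_upwards [hwait, hgossip, eventually_gt_atTop d] with e h1 h2 h3
  refine ⟨⟨hab, hpcb⟩, ⟨d, hbd, h3, had, hpcd, fun x hbx hxd hax => ?_, h1⟩, h2⟩
  by_contra hlt
  exact hmin x hxd ⟨hbx, hax, not_le.1 hlt⟩

/-! ### Asynchronous cycles -/

theorem Fair.exists_cycle (hF : R.Fair) (x : ℕ) : ∃ y, R.Cycle x y := by
  classical
  have hex : ∃ y, x ≤ y ∧ ∀ i, ∃ b e, x ≤ b ∧ e ≤ y ∧ R.Iteration i b e := by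
    choose b hb he using fun i => hF.exists_iteration i x
    obtain ⟨e, he, hxe⟩ := ((eventually_all.2 he).and (eventually_ge_atTop x)).exists
    exact ⟨e, hxe, fun i => ⟨b i, e, hb i, le_rfl, he i⟩⟩
  exact ⟨Nat.find hex, Nat.find_spec hex, fun y hy => Nat.find_min' hex hy⟩

theorem Fair.exists_cycles (hF : R.Fair) (x k : ℕ) : ∃ y, R.Cycles x k y := by
  induction k with
  | zero => exact ⟨x, .zero⟩
  | succ k ih =>
    obtain ⟨y, hy⟩ := ih
    obtain ⟨z, hz⟩ := hF.exists_cycle y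
    exact ⟨z, .succ hy hz⟩

theorem Cycles.trans {k l : ℕ} (h : R.Cycles x k y) (h' : R.Cycles y l z) :
    R.Cycles x (k + l) z := by
  induction h' with
  | zero => exact h
  | succ _ hz ih => exact .succ ih hz

theorem Cycles.le {k : ℕ} (h : R.Cycles x k y) : x ≤ y := by
  induction h with
  | zero => exact le_rfl
  | succ _ hz ih => exact ih.trans hz.1.1

theorem Cycles.exists_iteration (h : R.Cycles x 1 y) (i : Fin n) :
    ∃ b e, x ≤ b ∧ e ≤ y ∧ R.Iteration i b e := by
  cases h with
  | succ h h' => cases h with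
    | zero => exact h'.1.2 i

theorem Cycles.split {k : ℕ} (h : R.Cycles x (k + 1) z) : ∃ y, R.Cycles x k y ∧ R.Cycles y 1 z := by
  cases h with
  | succ h h' => exact ⟨_, h, .succ .zero h'⟩

end Execution

/-! ### The origin of timestamps in a single step. -/

section

variable {c c' : State n V} {a : Act n V} {i j k : Fin n}

theorem Step.idle_of_invokeWrite {v : V} (h : Step cap x c (.invokeWrite i v) c') :
    (c.node i).client = .idle := by
  cases h
  assumption

theorem Emits.mem_tsOf {m : Msg n V} (h : Emits c a c' j k m) {t : ℤ} (ht : t ∈ m.tsOf i k) :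
    t ∈ entryTs ((c.node j).reg i) ∨ t ∈ (c.node j).client.reqTs i ∨
      t ∈ entryTs ((c'.node j).reg i) := by
  cases h with
  | gossip ha hij =>
    obtain ⟨rfl, ht⟩ := ht
    exact .inl ht
  | write lReg acks ha hij hc => exact .inr (.inl (by rw [hc]; exact ht))
  | snapshot prev out acks ha hij hc => exact .inr (.inl (by rw [hc]; exact .inr ht))
  -- The reply carries the array after the update, that is, the one in `c'`.
  | writeAck | snapshotAck => exact .inr (.inr ht)

/-- A step creates only timestamps of node `i` that `ts` of node `i` takes into account. -/
theorem Step.mem_tsOf (h : Step cap x c a c') {t : ℤ} (ht : t ∈ c'.tsOf i) :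
    t ∈ c.tsOf i ∨ t ≤ (c'.node i).ts := by
  have hclient : ∀ {j t}, t ∈ (c.node j).client.reqTs i ∪ (c.node j).client.ackTs i → t ∈ c.tsOf i :=
    fun {j t} ht => .inr (.inl ⟨j, .inr (by rwa [Client.tsOf_eq])⟩)
  have hchan : ∀ {j k t}, (∃ p ∈ c.chan j k, t ∈ p.msg.tsOf i k) → t ∈ c.tsOf i :=
    fun {j k t} ht => .inr (.inr ⟨j, k, ht⟩)
  have hreg : ∀ {j t}, t ∈ entryTs ((c'.node j).reg i) → t ∈ c.tsOf i ∨ t ≤ (c'.node i).ts := by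
    intro j t ht
    rcases (h.nodeStep j).mem_reg ht with ht | ht | ⟨k, ht⟩ | ⟨-, ht⟩ | ⟨rfl, ht⟩
    exacts [.inl (.inr (.inl ⟨j, .inl ht⟩)), .inl (hclient (.inl ht)), .inl (hchan ht),
      .inl (hclient (.inr ht)), .inr ht]
  rcases ht with rfl | ⟨j, ht | ht⟩ | ⟨j, k, p, hp, ht⟩
  · exact .inr le_rfl
  · exact hreg ht
  · rw [Client.tsOf_eq] at ht
    rcases ht with ht | ht
    · rcases (h.nodeStep j).mem_reqTs ht with ht | ⟨ht, -⟩
      exacts [hreg ht, .inl (hclient (.inl ht))]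
    · rcases (h.nodeStep j).mem_ackTs ht with ⟨ht, -⟩ | ht | ⟨k, ht⟩
      exacts [.inl (hclient (.inr ht)), hreg ht, .inl (hchan ht)]
  · rcases h.mem_chan hp with hp | ⟨-, he⟩
    · exact .inl (hchan ⟨p, hp, ht⟩)
    · rcases he.mem_tsOf ht with ht | ht | ht
      exacts [.inl (.inr (.inl ⟨j, .inl ht⟩)), .inl (hclient (.inl ht)), hreg ht]

end

/-! ### Monotone quantities along an execution. -/

namespace Execution

variable {R : Execution n cap V} {i j k : Fin n} {p : Packet n V} {b s u w y z e K : ℕ}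

theorem ts_mono (R : Execution n cap V) (i : Fin n) : Monotone fun x => ((R.c x).node i).ts :=
  monotone_nat_of_le_succ fun x => ((R.step x).nodeStep i).ts_le

theorem ssn_mono (R : Execution n cap V) (i : Fin n) : Monotone fun x => ((R.c x).node i).ssn :=
  monotone_nat_of_le_succ fun x => ((R.step x).nodeStep i).ssn_le

theorem reg_mono (hij : j ≠ i) (h : x ≤ y) :
    entryLE (((R.c x).node j).reg i) (((R.c y).node j).reg i) := by
  induction y, h using Nat.le_induction with
  | base => exact entryLE_refl _
  | succ y h ih =>
    exact entryLE_trans ih (((R.step y).nodeStep j).reg_le fun h => (hij h.symm).elim)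

/-! ### Quorum accesses end -/

theorem access_mono (h : ∀ z, x ≤ z → z < y → ¬ Fresh (R.c z) (R.a z) i) (hxy : x ≤ y) :
    ((R.c y).node i).Reply = ((R.c x).node i).Reply ∧
      ∀ j, ((R.c x).node i).Acked j → ((R.c y).node i).Acked j := by
  induction y, hxy using Nat.le_induction with
  | base => exact ⟨rfl, fun _ => id⟩
  | succ y hxy ih =>
    obtain ⟨h1, h2⟩ := ih fun z hz hzy => h z hz (by omega)
    obtain ⟨-, -, h3, h4⟩ := ((R.step y).nodeStep i).access (h y hxy (Nat.lt_succ_self y))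
    exact ⟨h3.trans h1, fun j hj => h4 j (h2 j hj)⟩

theorem emits_of_deliver {t : ℕ} (hp : p.sentAt = s + 1) (h : R.a t = .deliver i j p) :
    s < t ∧ Emits (R.c s) (R.a s) (R.c (s + 1)) i j p.msg := by
  obtain ⟨s', -, h1, h2, h3⟩ := emits_of_mem (x := 0) (mem_chan_of_deliver h) (by omega)
  obtain rfl : s' = s := by omega
  exact ⟨h1, h3⟩

/-- The label of the request identifies step `s` as its sender, and a client step sends only to its
current broadcast position. -/
theorem RoundTrip.dest_eq (h : R.RoundTrip i j s u) : ((R.c s).node i).client.dest = j := by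
  obtain ⟨has, ⟨rfl, hd, -⟩ | ⟨hij, t, p, q, hp, ht, -⟩⟩ := h
  · exact hd
  · obtain ⟨-, hem⟩ := emits_of_deliver hp ht
    rw [has] at hem
    generalize p.msg = m at hem
    cases hem with
    | write lReg acks ha hij hc | snapshot prev out acks ha hij hc => rw [hc]; rfl
    | _ => contradiction

/-- The reply is one the access waits for: a `WRITEack` dominates `lReg` because the server merges
first, and a `SNAPSHOTack` repeats the sequence number. The awaited replies do not change before
step `u`, and what is stored there lasts until `e`. -/
theorem RoundTrip.acked (h : R.RoundTrip i j s u) (hue : u < e)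
    (hf : ∀ z, s ≤ z → z < e → ¬ Fresh (R.c z) (R.a z) i) : ((R.c e).node i).Acked j := by
  have hd := h.dest_eq
  obtain ⟨has, ⟨rfl, -, rfl⟩ | ⟨hij, t, p, q, hp, ht, hq, hu⟩⟩ := h
  · exact (access_mono (fun z hz hze => hf z (by omega) hze) hue).2 _
      (((R.step u).nodeStep j).acked_self (hf u le_rfl hue) has hd)
  · obtain ⟨hst, hemp⟩ := emits_of_deliver hp ht
    obtain ⟨htu, hemq⟩ := emits_of_deliver hq hu
    refine (access_mono (fun z hz hze => hf z (by omega) hze) hue).2 _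
      (((R.step u).nodeStep i).acked_of_deliver hu ?_)
    rw [(access_mono (fun z hz hzu => hf z hz (by omega)) (hst.trans htu).le).1]
    rw [has] at hemp
    rw [ht] at hemq
    unfold Node.Reply
    generalize hpm : p.msg = m at hemp
    generalize q.msg = m' at hemq
    cases hemp with
    | write lReg acks ha hij hc =>
      cases hemq with
      | writeAck p' r ha' hp' hm hr =>
        cases ha'
        cases hpm.symm.trans hm
        simp [hc, hr]
      | snapshotAck p' r s ha' hp' hm =>
        cases ha'
        cases hpm.symm.trans hm
      | _ => contradiction
    | snapshot prev out acks ha hij hc =>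
      cases hemq with
      | writeAck p' r ha' hp' hm hr =>
        cases ha'
        cases hpm.symm.trans hm
      | snapshotAck p' r s ha' hp' hm =>
        cases ha'
        cases hpm.symm.trans hm
        simp [hc]
      | _ => contradiction
    | _ => contradiction

theorem Cycles.roundTrip (h : R.Cycles x 1 y)
    (hf : ∀ z, x ≤ z → z < y → ¬ Fresh (R.c z) (R.a z) i) (j : Fin n) :
    ∃ s u, x ≤ s ∧ s < y ∧ u < y ∧ R.RoundTrip i j s u := by
  obtain ⟨b, e, hb, he, -, ⟨d, hbd, hde, -, -, -, hrt⟩, -⟩ := h.exists_iteration i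
  obtain ⟨s, u, hs, hu, hsu, -⟩ := hrt (fun h => hf d (by omega) (by omega) (.inl h))
    (fun z hz hze h => hf z (by omega) (by omega) (.inr h)) j
  refine ⟨s, u, by omega, ?_, by omega, hsu⟩
  obtain ⟨-, ⟨-, -, rfl⟩ | ⟨-, t, p, q, hp, ht, hq, hu'⟩⟩ := hsu
  · omega
  · have := (emits_of_deliver hp ht).1
    have := (emits_of_deliver hq hu').1
    omega

/-- Within three cycles, a node is idle or ends a quorum access. -/
theorem Cycles.exists_fresh (h : R.Cycles x 3 y) (i : Fin n) :
    ∃ z, x ≤ z ∧ z < y ∧ Fresh (R.c z) (R.a z) i := by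
  by_contra! hf
  obtain ⟨y₂, h, h₃⟩ := h.split
  obtain ⟨y₁, h₁, h₂⟩ := h.split
  have := h₁.le
  have := h₂.le
  have := h₃.le
  -- The first cycle alone completes a round-trip with every node, so afterwards any `until` test
  -- would succeed.
  have hacked : ∀ j, ((R.c y₁).node i).Acked j := by
    intro j
    obtain ⟨s, u, hs, -, hu, hrt⟩ := h₁.roundTrip (i := i) (fun z hz hzy => hf z hz (by omega)) j
    exact hrt.acked hu fun z hz hzy => hf z (by omega) (by omega)
  -- Each of the other two cycles contains a send to node `0`, so the broadcast must wrap around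
  -- between `s₂` and `s₃`.
  obtain ⟨s₂, u₂, hs₂, hs₂', -, hrt₂⟩ :=
    h₂.roundTrip (i := i) (fun z hz hzy => hf z (by omega) (by omega)) ⟨0, i.pos⟩
  obtain ⟨s₃, u₃, hs₃, hs₃', -, hrt₃⟩ :=
    h₃.roundTrip (i := i) (fun z hz hzy => hf z (by omega) (by omega)) ⟨0, i.pos⟩
  have hd₂ : ((R.c s₂).node i).client.dest = 0 := hrt₂.dest_eq
  have hd₃ : ((R.c s₃).node i).client.dest = 0 := hrt₃.dest_eq
  -- Wrapping around means failing the `until` test, which is excluded by `hacked`.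
  have hpos : ∀ z, s₂ + 1 ≤ z → z < y → 0 < ((R.c z).node i).client.dest := by
    intro z hz
    induction z, hz using Nat.le_induction with
    | base =>
      intro hy
      rw [((R.step s₂).nodeStep i).dest_succ (hf s₂ (by omega) (by omega)) hrt₂.1
        (hd₂ ▸ i.pos)]
      omega
    | succ z hz ih =>
      intro hy
      have hfz := hf z (by omega) (by omega)
      have hdz := ih (by omega)
      by_cases ha : R.a z = .client i
      · rcases lt_or_ge ((R.c z).node i).client.dest n with hlt | hge
        · rw [((R.step z).nodeStep i).dest_succ hfz ha hlt]
          omega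
        · refine (hfz (.inr ⟨ha, Node.quorumReached_of_acked i hge fun j => ?_⟩)).elim
          exact (access_mono (fun z hz hzy => hf z (by omega) (by omega)) (by omega)).2 j (hacked j)
      · rwa [((R.step z).nodeStep i).dest_eq hfz ha]
  have := hpos s₃ (by omega) hs₃'
  omega

end Execution

/-! ### Consequences of the transit bound. -/

namespace Execution

variable {R : Execution n cap V} {i j k : Fin n} {p : Packet n V} {b s u w y z e K : ℕ}

/-- Packets received `K` cycles after `c x` were sent after `c x`. -/
theorem TransitBound.emits (hT : R.TransitBound K) (h : R.Cycles x K y) (hyz : y ≤ z)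
    (hp : p ∈ (R.c z).chan i j) :
    ∃ s, x ≤ s ∧ s < z ∧ p.sentAt = s + 1 ∧ Emits (R.c s) (R.a s) (R.c (s + 1)) i j p.msg := by
  refine emits_of_mem hp ?_
  by_contra hlt
  have := h.le
  exact hlt (hT x y h i j p (mem_chan_of_sentAt_le hp hyz (by omega)))

/-! ### Timestamps -/

/-- The timestamps that are at most `ts` of node `i`, or at most that of the entry of node `i` in the
array of another node. -/
def knownTs (R : Execution n cap V) (i : Fin n) (x : ℕ) : Set ℤ :=
  {t | t ≤ ((R.c x).node i).ts ∨ ∃ j ≠ i, ∃ t' ∈ entryTs (((R.c x).node j).reg i), t ≤ t'}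

/-- This rests on `j ≠ i` in `knownTs`: the own entry of `i` can be lowered by a write. -/
theorem knownTs_mono (R : Execution n cap V) (i : Fin n) : Monotone (R.knownTs i) := by
  rintro x y hxy t (ht | ⟨j, hij, t', ht', hle⟩)
  · exact .inl (ht.trans (R.ts_mono i hxy))
  · obtain ⟨t'', ht'', hle'⟩ := exists_ge_of_entryLE (reg_mono hij hxy) ht'
    exact .inr ⟨j, hij, t'', ht'', hle.trans hle'⟩

theorem knownTs_of_le {t t' : ℤ} (h : t ≤ t') (ht' : t' ∈ R.knownTs i x) : t ∈ R.knownTs i x := by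
  rcases ht' with ht' | ⟨j, hij, t'', ht'', hle⟩
  exacts [.inl (h.trans ht'), .inr ⟨j, hij, t'', ht'', h.trans hle⟩]

/-- Three cycles after an arbitrary state, the array of a node dominates those that its ongoing
operation uses. -/
theorem Cycles.reqTs_le (h : R.Cycles x 3 y) (j : Fin n) (hyz : y ≤ z) :
    ∀ t ∈ ((R.c z).node j).client.reqTs i, ∃ t' ∈ entryTs (((R.c z).node j).reg i), t ≤ t' := by
  obtain ⟨w, -, hwy, hw⟩ := h.exists_fresh j
  have hwz : w + 1 ≤ z := by omega
  clear hyz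
  induction z, hwz using Nat.le_induction with
  | base =>
    intro t ht
    rcases ((R.step w).nodeStep j).mem_reqTs ht with ht | ⟨-, hf⟩
    exacts [⟨t, ht, le_rfl⟩, (hf hw).elim]
  | succ z _ ih =>
    intro t ht
    rcases ((R.step z).nodeStep j).mem_reqTs ht with ht | ⟨ht, hf⟩
    · exact ⟨t, ht, le_rfl⟩
    · obtain ⟨t', ht', hle⟩ := ih t ht
      obtain ⟨t'', ht'', hle'⟩ := exists_ge_of_entryLE
        -- A write is invoked only at an idle node, so during the access even the own entry cannot
        -- be lowered.
        (((R.step z).nodeStep j).reg_le fun _ v ha =>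
          hf (.inl (Step.idle_of_invokeWrite (ha ▸ R.step z)))) ht'
      exact ⟨t'', ht'', hle.trans hle'⟩

/-- After `K` cycles every packet from `j` was sent after `c x`, from arrays with known timestamps,
and known timestamps stay known. -/
theorem TransitBound.tsOf_subset (hT : R.TransitBound K) (h : R.Cycles x K y)
    (hreg : ∀ z ≥ x, entryTs (((R.c z).node j).reg i) ⊆ R.knownTs i z)
    (hreq : ∀ z ≥ x, ((R.c z).node j).client.reqTs i ⊆ R.knownTs i z) (hyz : y ≤ z)
    (hp : p ∈ (R.c z).chan j k) : p.msg.tsOf i k ⊆ R.knownTs i z := by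
  intro t ht
  obtain ⟨s, hxs, hsz, -, he⟩ := hT.emits h hyz hp
  rcases he.mem_tsOf ht with ht | ht | ht
  · exact R.knownTs_mono i hsz.le (hreg s hxs ht)
  · exact R.knownTs_mono i hsz.le (hreq s hxs ht)
  · exact R.knownTs_mono i hsz (hreg (s + 1) (by omega) ht)

/-- Once the messages of the other nodes carry only known timestamps, the own entry of a node is
known forever after a pass through the first lines of its do-forever loop. -/
theorem Cycles.reg_subset (h : R.Cycles x 1 y)
    (hreq : ∀ z ≥ x, ∀ t ∈ ((R.c z).node i).client.reqTs i,
      ∃ t' ∈ entryTs (((R.c z).node i).reg i), t ≤ t')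
    (hchan : ∀ z ≥ x, ∀ j ≠ i, ∀ p ∈ (R.c z).chan j i, p.msg.tsOf i i ⊆ R.knownTs i z)
    (hyz : y ≤ z) : entryTs (((R.c z).node i).reg i) ⊆ R.knownTs i z := by
  obtain ⟨b, e, hxb, hey, ⟨hab, hpc⟩, ⟨d, hbd, hde, -⟩, -⟩ := h.exists_iteration i
  have hbz : b + 1 ≤ z := by omega
  clear hyz
  induction z, hbz using Nat.le_induction with
  | base => exact fun t ht => .inl (((R.step b).nodeStep i).reg_le_ts_of_loopFirst hab hpc ht)
  | succ z hbz ih =>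
    intro t ht
    have hmono := R.knownTs_mono i (Nat.le_succ z)
    rcases ((R.step z).nodeStep i).mem_reg ht with ht | ht | ⟨j, p, hp, ht⟩ | ⟨h, -⟩ | ⟨-, ht⟩
    · exact hmono (ih ht)
    · obtain ⟨t', ht', hle⟩ := hreq z (by omega) t ht
      exact hmono (knownTs_of_le hle (ih ht'))
    · refine hmono (hchan z (by omega) j ?_ p hp ht)
      rintro rfl
      simp [R.chan_self] at hp
    -- Stored acknowledgments may still be corrupt at this stage. For the own entry this is
    -- harmless, as `merge` accounts for them in `ts`.
    · exact (h rfl).elim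
    · exact .inl ht

/-- Once the arrays of all nodes and all messages carry only known timestamps, so do the stored
acknowledgments after three cycles. -/
theorem Cycles.ackTs_subset (h : R.Cycles x 3 y)
    (hreg : ∀ z ≥ x, ∀ j, entryTs (((R.c z).node j).reg i) ⊆ R.knownTs i z)
    (hchan : ∀ z ≥ x, ∀ j k, ∀ p ∈ (R.c z).chan j k, p.msg.tsOf i k ⊆ R.knownTs i z)
    (j : Fin n) (hyz : y ≤ z) : ((R.c z).node j).client.ackTs i ⊆ R.knownTs i z := by
  obtain ⟨w, hxw, hwy, hw⟩ := h.exists_fresh j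
  have hwz : w + 1 ≤ z := by omega
  clear hyz
  have key : ∀ z ≥ x, ∀ t ∈ ((R.c (z + 1)).node j).client.ackTs i,
      (t ∈ ((R.c z).node j).client.ackTs i ∧ ¬ Fresh (R.c z) (R.a z) j) ∨
        t ∈ R.knownTs i (z + 1) := by
    intro z hz t ht
    rcases ((R.step z).nodeStep j).mem_ackTs ht with ht | ht | ⟨k, p, hp, ht⟩
    · exact .inl ht
    · exact .inr (hreg (z + 1) (by omega) j ht)
    · exact .inr (R.knownTs_mono i (Nat.le_succ z) (hchan z hz k j p hp ht))
  induction z, hwz using Nat.le_induction with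
  | base => exact fun t ht => (key w hxw t ht).resolve_left fun h => h.2 hw
  | succ z hwz ih =>
    intro t ht
    rcases key z (by omega) t ht with ⟨ht, -⟩ | ht
    exacts [R.knownTs_mono i (Nat.le_succ z) (ih ht), ht]

/-- After the gossip of `K + 1` cycles, `ts` of node `i` is at least the known timestamps. -/
theorem TransitBound.knownTs_le (hT : R.TransitBound K) (h : R.Cycles x K y)
    (h' : R.Cycles y 1 z) {t : ℤ} (ht : t ∈ R.knownTs i x) : t ≤ ((R.c z).node i).ts := by
  rcases ht with ht | ⟨j, hij, t', ht', hle⟩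
  · exact ht.trans (R.ts_mono i (h.le.trans h'.le))
  · obtain ⟨b, e, hyb, hez, -, -, hgossip⟩ := h'.exists_iteration j
    obtain ⟨u, p, hbu, hue, hau, hp⟩ := hgossip i hij.symm
    -- The gossip received in the last cycle was sent after `c x`, so it carries an entry at least
    -- as large as the copy that `j` held at `c x`.
    obtain ⟨s, hxs, -, -, hem⟩ := hT.emits h (by omega) (mem_chan_of_deliver hau)
    generalize hm : p.msg = m at hem hp
    cases hem with
    | gossip ha hij' =>
      obtain ⟨t'', ht'', hle'⟩ := exists_ge_of_entryLE (reg_mono hij hxs) ht'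
      exact (hle.trans hle').trans ((((R.step u).nodeStep i).le_ts_of_gossip hau hm ht'').trans
        (R.ts_mono i (show u + 1 ≤ z by omega)))
    | _ => simp [Msg.kind] at hp

/-- The set `S` is frozen at `c x`: all later timestamps are bounded by `ts`, so gossip need not
chase a moving target. -/
theorem tsOf_subset_of_le {S : Set ℤ} (hxy : x ≤ y) (h : (R.c x).tsOf i ⊆ S) :
    ∀ t ∈ (R.c y).tsOf i, t ∈ S ∨ t ≤ ((R.c y).node i).ts := by
  induction y, hxy using Nat.le_induction with
  | base => exact fun t ht => .inl (h ht)
  | succ y hxy ih =>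
    intro t ht
    rcases (R.step y).mem_tsOf ht with ht | ht
    · exact (ih t ht).imp_right fun h => h.trans (R.ts_mono i (Nat.le_succ y))
    · exact .inr ht

/-! ### Snapshot sequence numbers -/

/-- A request sent after `c x` carries the `ssn` of that moment, and `ssn` only grows. -/
theorem TransitBound.snapshot_le (hT : R.TransitBound K) (h : R.Cycles x K y) (hyz : y ≤ z)
    (hp : p ∈ (R.c z).chan i j) {r : Reg n V} {s : ℤ} (hm : p.msg = .snapshot r s) :
    s ≤ ((R.c z).node i).ssn := by
  obtain ⟨s₀, -, hs₀, -, he⟩ := hT.emits h hyz hp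
  rw [hm] at he
  cases he with
  | snapshot => exact R.ssn_mono i hs₀.le

/-- Two transit periods: the second makes the reply recent enough that the request it answers was
itself sent after the start of the first. -/
theorem TransitBound.snapshotAck_le (hT : R.TransitBound K) (h : R.Cycles x K y)
    (h' : R.Cycles w K u) (hyw : y ≤ w) (huz : u ≤ z) (hp : p ∈ (R.c z).chan j i) {r : Reg n V}
    {s : ℤ} (hm : p.msg = .snapshotAck r s) : s ≤ ((R.c z).node i).ssn := by
  obtain ⟨s₀, hws, hs₀, -, he⟩ := hT.emits h' huz hp
  rw [hm] at he
  cases he with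
  | snapshotAck p' r' s ha hp' hm' =>
    exact (hT.snapshot_le h (hyw.trans hws) hp' hm').trans (R.ssn_mono i hs₀.le)

/-- Some pass through the first line of the loop in this cycle purges the store, and later additions
carry the current `ssn`. -/
theorem Cycles.ackSsn_le (h : R.Cycles x 1 y) (hyz : y ≤ z) :
    ∀ s ∈ ((R.c z).node i).client.ackSsn, s ≤ ((R.c z).node i).ssn := by
  obtain ⟨b, e, hxb, hey, hb, ⟨d, hbd, hde, -⟩, -⟩ := h.exists_iteration i
  have hbz : b + 1 ≤ z := by omega
  clear hyz
  induction z, hbz using Nat.le_induction with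
  | base =>
    exact fun s hs => (((R.step b).nodeStep i).mem_ackSsn hs).resolve_left fun h => h.2 hb
  | succ z hbz ih =>
    intro s hs
    rcases ((R.step z).nodeStep i).mem_ackSsn hs with ⟨hs, -⟩ | hs
    exacts [(ih s hs).trans (R.ssn_mono i (Nat.le_succ z)), hs]

end Execution

end Snap

/-! ### Assembling the phases. -/

theorem mainTheorem1 (K : ℕ) :
    ∃ C : ℕ, ∀ (n cap : ℕ) (V : Type*) (R : Snap.Execution n cap V),
      R.Fair → R.TransitBound K →
      ∃ x y, R.Cycles 0 C y ∧ x ≤ y ∧ (R.c x).TsConsistent ∧ (R.c x).SsnConsistent := by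
  -- The summands, in order: accesses end; messages of the other nodes are clean; the own entry is
  -- known; all messages are clean; stored acknowledgments are clean; transit and then arrival of
  -- gossip.
  refine ⟨3 + K + 1 + K + 3 + K + 1, fun n cap V R hF hT => ?_⟩
  obtain ⟨y₁, h₁⟩ := hF.exists_cycles 0 3
  obtain ⟨y₂, h₂⟩ := hF.exists_cycles y₁ K
  obtain ⟨y₃, h₃⟩ := hF.exists_cycles y₂ 1
  obtain ⟨y₄, h₄⟩ := hF.exists_cycles y₃ K
  obtain ⟨y₅, h₅⟩ := hF.exists_cycles y₄ 3
  obtain ⟨y₆, h₆⟩ := hF.exists_cycles y₅ K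
  obtain ⟨y₇, h₇⟩ := hF.exists_cycles y₆ 1
  have l₂ := h₂.le
  have l₃ := h₃.le
  have l₄ := h₄.le
  have l₅ := h₅.le
  have l₆ := h₆.le
  have l₇ := h₇.le
  refine ⟨y₇, y₇, (((((h₁.trans h₂).trans h₃).trans h₄).trans h₅).trans h₆).trans h₇, le_rfl,
    fun i t ht => ?_, fun i s hs => ?_⟩
  · have hreg' : ∀ z, ∀ j ≠ i, Snap.entryTs (((R.c z).node j).reg i) ⊆ R.knownTs i z :=
      fun z j hij t ht => .inr ⟨j, hij, t, ht, le_rfl⟩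
    have hchan' : ∀ z ≥ y₂, ∀ j ≠ i, ∀ k, ∀ p ∈ (R.c z).chan j k,
        p.msg.tsOf i k ⊆ R.knownTs i z := by
      refine fun z hz j hij k p hp => hT.tsOf_subset h₂ (fun z _ => hreg' z j hij) ?_ hz hp
      intro z hz t ht
      obtain ⟨t', ht', hle⟩ := h₁.reqTs_le j hz t ht
      exact Snap.Execution.knownTs_of_le hle (hreg' z j hij ht')
    have hreg : ∀ z ≥ y₃, ∀ j, Snap.entryTs (((R.c z).node j).reg i) ⊆ R.knownTs i z := by
      intro z hz j
      rcases eq_or_ne j i with rfl | hij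
      · exact h₃.reg_subset (fun z hz => h₁.reqTs_le j (by omega))
          (fun z hz k hk => hchan' z hz k hk j) hz
      · exact hreg' z j hij
    have hreq : ∀ z ≥ y₃, ∀ j, ((R.c z).node j).client.reqTs i ⊆ R.knownTs i z := by
      intro z hz j t ht
      obtain ⟨t', ht', hle⟩ := h₁.reqTs_le j (by omega) t ht
      exact Snap.Execution.knownTs_of_le hle (hreg z hz j ht')
    have hchan : ∀ z ≥ y₄, ∀ j k, ∀ p ∈ (R.c z).chan j k, p.msg.tsOf i k ⊆ R.knownTs i z :=
      fun z hz j k p hp =>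
        hT.tsOf_subset h₄ (fun z hz => hreg z hz j) (fun z hz => hreq z hz j) hz hp
    have hack : ∀ j, ((R.c y₅).node j).client.ackTs i ⊆ R.knownTs i y₅ := fun j =>
      h₅.ackTs_subset (fun z hz => hreg z (by omega)) hchan j le_rfl
    have hall : (R.c y₅).tsOf i ⊆ R.knownTs i y₅ := by
      rintro t (rfl | ⟨j, ht | ht⟩ | ⟨j, k, p, hp, ht⟩)
      · exact .inl le_rfl
      · exact hreg y₅ (by omega) j ht
      · rw [Snap.Client.tsOf_eq] at ht
        exact ht.elim (fun h => hreq y₅ (by omega) j h) fun h => hack j h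
      · exact hchan y₅ l₅ j k p hp ht
    -- A timestamp at `y₇` either was known at `y₅`, and gossip has delivered that bound to `i`, or
    -- is already bounded by `ts`.
    exact (Snap.Execution.tsOf_subset_of_le (l₆.trans l₇) hall t ht).elim
      (fun h => hT.knownTs_le h₆ h₇ h) id
  · rcases hs with rfl | ⟨prev, out, d, acks, hc, a, ha, rfl⟩ | ⟨j, p, hp, r, hm⟩ | ⟨j, p, hp, r, hm⟩
    · exact le_rfl
    · exact h₇.ackSsn_le le_rfl _ (by rw [hc]; exact ⟨a, ha, rfl⟩)
    · exact hT.snapshot_le h₆ l₇ hp hm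
    -- The disjoint `K`-cycle blocks ending at `y₄` and `y₆` serve as the two transit periods.
    · exact hT.snapshotAck_le h₄ h₆ l₅ l₇ hp hm
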